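/- Let $M$ be a compact connected complex surface (a compact connected complex manifold of complex dimension 2) with complex structure $J$. Let $g$ be an indefinite Kähler–Einstein metric on $M$ with Einstein constant $\lambda\in\mathbb{R}$, $\lambda\neq 0$; that is, $g$ is a smooth pseudo-Riemannian metric on $M$, neither positive nor negative definite, with $g(Jx,Jy)=g(x,y)$, whose Kähler form $\omega(x,y)=g(Jx,y)$ is closed, and whose Ricci tensor satisfies $\mathrm{Ric}=\lambda g$. Then the Kodaira dimension of $M$ is $\mathrm{Kod}(M)=-\infty$ (equivalently, $H^0(M,K_M^{m})=0$ for all $m\ge 1$, where $K_M$ is the canonical line bundle), and $c_1^2(M)=\int_M c_1(M)\wedge c_1(M)<0$, where $c_1(M)$ is the first Chern class in $H^2(M,\mathbb{R})$ and $M$ carries the orientation given by its complex structure. -/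

import Mathlib

set_option maxSynthPendingDepth 3

open scoped Manifold ContDiff Topology TensorProduct

noncomputable section

namespace ComplexSurface

/-- The model space `ℂ²` of a complex surface. -/
abbrev C2 : Type := Fin 2 → ℂ

/-! ### Coordinate formulas on an open subset of a vector space

Here `G z u v` is the coordinate expression of a pseudo-Riemannian metric at the point `z`. -/

section Coordinates

variable {V : Type*} [NormedAddCommGroup V] [NormedSpace ℝ V]

/-- The Christoffel symbols `Γ z u v = ∇_u v` (for constant vector fields `u`, `v`) of the Levi-Civita
connection of `G`, given by the Koszul formula
`2 G(∇_u v, w) = ∂_u G(v, w) + ∂_v G(u, w) - ∂_w G(u, v)`. -/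
def christoffel (G : V → V →L[ℝ] V →L[ℝ] ℝ) (z : V) : V →L[ℝ] V →L[ℝ] V :=
  let D : V →L[ℝ] V →L[ℝ] V →L[ℝ] ℝ := fderiv ℝ G z
  let D' : V →L[ℝ] V →L[ℝ] V →L[ℝ] ℝ :=
    (ContinuousLinearMap.flipₗᵢ ℝ V V ℝ).toContinuousLinearEquiv.toContinuousLinearMap ∘L D.flip
  let S : V →L[ℝ] V →L[ℝ] V →L[ℝ] ℝ := (1 / 2 : ℝ) • (D + D.flip - D')
  (ContinuousLinearMap.compL ℝ V (V →L[ℝ] ℝ) V (G z).inverse) ∘L S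

/-- The endomorphism `u ↦ R(u, v) w`, where
`R(u, v) w = ∇_u ∇_v w - ∇_v ∇_u w - ∇_[u, v] w` is the curvature tensor of `G`. -/
def curvatureEnd (G : V → V →L[ℝ] V →L[ℝ] ℝ) (z v w : V) : V →L[ℝ] V :=
  let Γ : V →L[ℝ] V →L[ℝ] V := christoffel G z
  let DΓ : V →L[ℝ] V →L[ℝ] V →L[ℝ] V := fderiv ℝ (christoffel G) z
  (DΓ.flip v).flip w - (DΓ v).flip w + Γ.flip (Γ v w) - (Γ v) ∘L (Γ.flip w)

/-- The Ricci tensor `Ric(v, w) = tr (u ↦ R(u, v) w)` of `G` at `z`. -/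
def ricci (G : V → V →L[ℝ] V →L[ℝ] ℝ) (z v w : V) : ℝ :=
  LinearMap.trace ℝ V (curvatureEnd G z v w : V →ₗ[ℝ] V)

end Coordinates

/-- Multiplication by `i` on `ℂ²`, as a real linear map. -/
def mulI : C2 →L[ℝ] C2 := Complex.I • ContinuousLinearMap.id ℝ C2

/-- The 1-form `d^c f = i (∂̄ - ∂) f = - df ∘ J` of a real function `f`. -/
def dc (f : C2 → ℝ) (z : C2) : C2 [⋀^Fin 1]→L[ℝ] ℝ :=
  ContinuousAlternatingMap.ofSubsingleton ℝ C2 ℝ (0 : Fin 1) (-(fderiv ℝ f z ∘L mulI))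

/-- The real 2-form `i ∂∂̄ f = (1/2) d d^c f` of a real function `f`. -/
def iddbar (f : C2 → ℝ) (z : C2) : C2 [⋀^Fin 2]→L[ℝ] ℝ :=
  (1 / 2 : ℝ) • extDeriv (dc f) z

/-- A bilinear form `B` with `B v v = 0`, as an alternating form. -/
def alternatingOfBilin (B : C2 →L[ℝ] C2 →L[ℝ] ℝ) (hB : ∀ v, B v v = 0) :
    C2 [⋀^Fin 2]→L[ℝ] ℝ where
  toFun v := B (v 0) (v 1)
  map_update_add' := by
    intro _ v i a b
    fin_cases i <;> simp [Function.update]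
  map_update_smul' := by
    intro _ v i a b
    fin_cases i <;> simp [Function.update]
  cont := by fun_prop
  map_eq_zero_of_eq' := by
    intro v i j h hij
    have h01 : v 0 = v 1 := by
      fin_cases i <;> fin_cases j <;> simp_all
    simp only [h01, hB]

/-! ### Tangent spaces and differential forms on a complex surface -/

variable {M : Type*} [TopologicalSpace M] [ChartedSpace C2 M]

/-- The real tangent space of `M` at `x`. -/
abbrev T (x : M) : Type := TangentSpace 𝓘(ℝ, C2) x

/-- The almost complex structure of `M`: multiplication by `i` on the tangent spaces. -/
def J (x : M) : T x →L[ℝ] T x := mulI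

/-- The bilinear forms on tangent spaces `B`, expressed in the chart `e`. -/
def bilinInChart (B : ∀ x : M, T x →L[ℝ] T x →L[ℝ] ℝ) (e : OpenPartialHomeomorph M C2) (z : C2) :
    C2 →L[ℝ] C2 →L[ℝ] ℝ :=
  let D : C2 →L[ℝ] C2 := mfderiv 𝓘(ℝ, C2) 𝓘(ℝ, C2) e.symm z
  let b : C2 →L[ℝ] C2 →L[ℝ] ℝ := B (e.symm z)
  b.bilinearComp D D

/-- The (not necessarily smooth) `k`-forms on `M`. -/
abbrev RawForm (M : Type*) [TopologicalSpace M] [ChartedSpace C2 M] (k : ℕ) :=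
  ∀ x : M, T x [⋀^Fin k]→L[ℝ] ℝ

/-- The expression of a form in the chart `e`, i.e. its pull-back under `e⁻¹`. -/
def RawForm.inChart {k : ℕ} (η : RawForm M k) (e : OpenPartialHomeomorph M C2) (z : C2) :
    C2 [⋀^Fin k]→L[ℝ] ℝ :=
  (η (e.symm z)).compContinuousLinearMap (mfderiv 𝓘(ℝ, C2) 𝓘(ℝ, C2) e.symm z)

/-- Smooth forms. -/
def RawForm.IsSmooth {k : ℕ} (η : RawForm M k) : Prop :=
  ∀ e ∈ atlas C2 M, ContDiffOn ℝ ∞ (η.inChart e) e.target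

/-- `dη = ζ`, where `d` is computed in charts. -/
def RawForm.HasExtDeriv {k : ℕ} (η : RawForm M k) (ζ : RawForm M (k + 1)) : Prop :=
  ∀ e ∈ atlas C2 M, ∀ z ∈ e.target, extDeriv (η.inChart e) z = ζ.inChart e z

/-- The wedge product of two alternating forms of degree 2. -/
def wedge {V : Type*} [AddCommGroup V] [Module ℝ V] (α β : V [⋀^Fin 2]→ₗ[ℝ] ℝ) :
    V [⋀^Fin 4]→ₗ[ℝ] ℝ :=
  ((LinearMap.mul' ℝ ℝ).compAlternatingMap (α.domCoprod β)).domDomCongr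
    (finSumFinEquiv : Fin 2 ⊕ Fin 2 ≃ Fin 4)

/-- A complex surface is in particular a smooth real manifold. -/
theorem isManifold_real [IsManifold 𝓘(ℂ, C2) ω M] : IsManifold 𝓘(ℝ, C2) ∞ M := by
  refine isManifold_of_contDiffOn 𝓘(ℝ, C2) ∞ M fun e e' he he' => ?_
  have h := (contDiffGroupoid ω 𝓘(ℂ, C2)).compatible he he'
  have h' := (mem_groupoid_of_pregroupoid.mp h).1
  exact (ContDiffOn.restrict_scalars ℝ h').of_le le_top

/-- A smooth partition of unity on `M` subordinate to the charts `chartAt C2 x`, `x : M`. -/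
def chartPartition (M : Type*) [TopologicalSpace M] [ChartedSpace C2 M] [IsManifold 𝓘(ℂ, C2) ω M]
    [T2Space M] [CompactSpace M] : SmoothPartitionOfUnity M 𝓘(ℝ, C2) M Set.univ :=
  haveI : IsManifold 𝓘(ℝ, C2) ∞ M := isManifold_real
  (SmoothPartitionOfUnity.exists_isSubordinate_chartAt_source 𝓘(ℝ, C2) M).choose

/-- The positively oriented real basis `∂/∂x₁, ∂/∂y₁, ∂/∂x₂, ∂/∂y₂` of `ℂ²`. -/
def orientedBasis : Fin 4 → C2 :=
  ![![1, 0], ![Complex.I, 0], ![0, 1], ![0, Complex.I]]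

/-- The integral over `M`, with its complex orientation, of a 4-form. -/
def integral [IsManifold 𝓘(ℂ, C2) ω M] [T2Space M] [CompactSpace M]
    (μ : ∀ x : M, T x [⋀^Fin 4]→ₗ[ℝ] ℝ) : ℝ :=
  ∑ᶠ p : M, ∫ z in (chartAt C2 p).target,
    chartPartition M p ((chartAt C2 p).symm z) *
      μ ((chartAt C2 p).symm z)
        (fun i => mfderiv 𝓘(ℝ, C2) 𝓘(ℝ, C2) (chartAt C2 p).symm z (orientedBasis i))

/-- The number `∫_M α ∧ β` for two 2-forms. -/
def intersection [IsManifold 𝓘(ℂ, C2) ω M] [T2Space M] [CompactSpace M] (α β : RawForm M 2) : ℝ :=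
  integral fun x => wedge (α x).toAlternatingMap (β x).toAlternatingMap

/-! ### The canonical bundle, pluricanonical sections and the Kodaira dimension -/

/-- The fibre of the canonical bundle `K` at `x`: the complex alternating 2-forms on the
(complex) tangent space of `M` at `x`. -/
abbrev K (x : M) : Type := (TangentSpace 𝓘(ℂ, C2) x) [⋀^Fin 2]→ₗ[ℂ] ℂ

/-- The local frame `dz₁ ∧ dz₂` of the canonical bundle given by a chart `e`. -/
def frame (e : OpenPartialHomeomorph M C2) (x : M) : K x :=
  (Pi.basisFun ℂ (Fin 2)).det.compLinearMap
    (mfderiv 𝓘(ℂ, C2) 𝓘(ℂ, C2) e x : TangentSpace 𝓘(ℂ, C2) x →L[ℂ] C2).toLinearMap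

/-- The holomorphic sections of `K^m`: in each chart they are of the form
`f(z) (dz₁ ∧ dz₂)^m` with `f` holomorphic. -/
def pluricanonicalSections (M : Type*) [TopologicalSpace M] [ChartedSpace C2 M] (m : ℕ) :
    Submodule ℂ (∀ x : M, ⨂[ℂ] _ : Fin m, K x) where
  carrier := {s | ∀ e ∈ atlas C2 M, ∃ f : C2 → ℂ, DifferentiableOn ℂ f e.target ∧
    ∀ z ∈ e.target, s (e.symm z) = f z • PiTensorProduct.tprod ℂ (fun _ => frame e (e.symm z))}
  add_mem' := by
    intro s t hs ht e he
    obtain ⟨f, hf, hsf⟩ := hs e he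
    obtain ⟨k, hk, htk⟩ := ht e he
    refine ⟨fun z => f z + k z, hf.add hk, fun z hz => ?_⟩
    rw [Pi.add_apply, hsf z hz, htk z hz, add_smul]
  zero_mem' := by
    intro e _
    exact ⟨fun _ => 0, differentiableOn_const 0, fun z _ => by simp⟩
  smul_mem' := by
    intro c s hs e he
    obtain ⟨f, hf, hsf⟩ := hs e he
    refine ⟨fun z => c * f z, hf.const_mul c, fun z hz => ?_⟩
    rw [Pi.smul_apply, hsf z hz, mul_smul]

/-- The `m`-th plurigenus `P_m(M) = dim H⁰(M, K^m)`. -/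
def plurigenus (M : Type*) [TopologicalSpace M] [ChartedSpace C2 M] (m : ℕ) : ℕ∞ :=
  Cardinal.toENat (Module.rank ℂ (pluricanonicalSections M m))

open Classical in
/-- The Kodaira dimension of `M`: it is `-∞` (written `⊥`) if all the plurigenera `P_m`, `m ≥ 1`,
vanish; otherwise it is the growth order of the plurigenera, i.e. the smallest `k ≥ 0` such that
`P_m = O(m^k)`. -/
def kodairaDimension (M : Type*) [TopologicalSpace M] [ChartedSpace C2 M] : WithBot ℕ∞ :=
  if ∀ m : ℕ, 1 ≤ m → plurigenus M m = 0 then ⊥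
  else ((⨅ (k : ℕ) (_ : ∃ C : ℕ, ∀ m : ℕ, 1 ≤ m → plurigenus M m ≤ C * m ^ k), (k : ℕ∞) : ℕ∞) :
    WithBot ℕ∞)

/-! ### The first Chern class -/

/-- A smooth Hermitian metric on the canonical line bundle, given by its squared norm
(the fibres are one-dimensional, so that homogeneity and positivity make it a Hermitian form). -/
structure CanonicalHermitianMetric (M : Type*) [TopologicalSpace M] [ChartedSpace C2 M] where
  /-- the squared norm -/
  normSq : ∀ x : M, K x → ℝ
  normSq_smul : ∀ (x : M) (c : ℂ) (α : K x), normSq x (c • α) = ‖c‖ ^ 2 * normSq x α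
  normSq_pos : ∀ (x : M) (α : K x), α ≠ 0 → 0 < normSq x α
  smooth : ∀ e ∈ atlas C2 M,
    ContDiffOn ℝ ∞ (fun z => normSq (e.symm z) (frame e (e.symm z))) e.target

/-- `θ` is the first Chern form of `M` defined by the Hermitian metric `h` on `K`. The curvature of
the Chern connection of `(K, h)` is `F = -∂∂̄ log h(dz₁ ∧ dz₂)`, and
`c₁(M) = -c₁(K)` is represented by `-(i/2π) F = (1/2π) i∂∂̄ log h(dz₁ ∧ dz₂)`. -/
def IsChernForm (h : CanonicalHermitianMetric M) (θ : RawForm M 2) : Prop :=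
  ∀ e ∈ atlas C2 M, ∀ z ∈ e.target, θ.inChart e z =
    (1 / (2 * Real.pi)) •
      iddbar (fun w => Real.log (h.normSq (e.symm w) (frame e (e.symm w)))) z

/-- `θ` is a smooth form in the de Rham class of the first Chern class `c₁(M)`, i.e. it differs from
the Chern form of some Hermitian metric on `K` by an exact form. -/
def RepresentsFirstChernClass (θ : RawForm M 2) : Prop :=
  ∃ (h : CanonicalHermitianMetric M) (θ₀ : RawForm M 2) (η : RawForm M 1),
    IsChernForm h θ₀ ∧ η.IsSmooth ∧ η.HasExtDeriv (θ - θ₀)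

/-- `c₁²(M) = r`: the class `c₁(M)` has representatives `θ`, and `∫_M θ ∧ θ = r` for all of them. -/
def HasFirstChernSquare (M : Type*) [TopologicalSpace M] [ChartedSpace C2 M]
    [IsManifold 𝓘(ℂ, C2) ω M] [T2Space M] [CompactSpace M] (r : ℝ) : Prop :=
  (∃ θ : RawForm M 2, RepresentsFirstChernClass θ) ∧
    ∀ θ : RawForm M 2, RepresentsFirstChernClass θ → intersection θ θ = r

/-! ### Indefinite Kähler–Einstein metrics -/

/-- A smooth pseudo-Riemannian metric on `M` that is Hermitian, `g(Jx, Jy) = g(x, y)`. -/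
structure HermitianPseudoMetric (M : Type*) [TopologicalSpace M] [ChartedSpace C2 M] where
  /-- the scalar products on the tangent spaces -/
  toFun : ∀ x : M, T x →L[ℝ] T x →L[ℝ] ℝ
  smooth : ∀ e ∈ atlas C2 M, ContDiffOn ℝ ∞ (bilinInChart toFun e) e.target
  symm : ∀ (x : M) (v w : T x), toFun x v w = toFun x w v
  nondegenerate : ∀ (x : M) (v : T x), (∀ w, toFun x v w = 0) → v = 0
  hermitian : ∀ (x : M) (v w : T x), toFun x (J x v) (J x w) = toFun x v w

namespace HermitianPseudoMetric

variable (g : HermitianPseudoMetric M)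

/-- The form `(v, w) ↦ g(Jv, w)` is alternating. -/
theorem apply_J_self (x : M) (v : T x) : g.toFun x (J x v) v = 0 := by
  have h1 : J x (J x v) = -v := by
    have h : ∀ u : C2, Complex.I • (Complex.I • u) = -u := fun u => by
      rw [smul_smul, Complex.I_mul_I, neg_one_smul]
    exact h v
  have h2 := g.hermitian x (J x v) v
  rw [h1, map_neg, neg_apply, g.symm x v] at h2
  linarith

/-- The Kähler form `ω(v, w) = g(Jv, w)`. -/
def kahlerForm : RawForm M 2 := fun x =>
  alternatingOfBilin ((g.toFun x : C2 →L[ℝ] C2 →L[ℝ] ℝ) ∘L (J x : C2 →L[ℝ] C2))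
    (g.apply_J_self x)

/-- `g` is Kähler: its Kähler form is closed. -/
def IsKahler : Prop := g.kahlerForm.HasExtDeriv 0

/-- `g` is indefinite: neither positive nor negative definite. -/
def IsIndefinite : Prop :=
  ¬ (∀ (x : M) (v : T x), v ≠ 0 → 0 < g.toFun x v v) ∧
    ¬ (∀ (x : M) (v : T x), v ≠ 0 → g.toFun x v v < 0)

/-- `Ric = lam • g`. -/
def IsEinstein (lam : ℝ) : Prop :=
  ∀ e ∈ atlas C2 M, ∀ z ∈ e.target, ∀ v w : C2,
    ricci (bilinInChart g.toFun e) z v w = lam * bilinInChart g.toFun e z v w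

end HermitianPseudoMetric

end ComplexSurface

end

/-! ### The derivative of the determinant -/

/-! The volume density of `g` defines a Hermitian metric on the canonical bundle `K`: the squared
norm of `dz₁ ∧ dz₂` is `D^(-1/2)`, where `D` is the determinant of the real 4 × 4 Gram matrix. This
metric is positive whatever the signature of `g`. Its curvature is governed by `log D`. For a Kähler
metric the Levi-Civita connection is complex linear and the trace of `Γ_u` is half the derivative of
`log D` along `u`, so the first Bianchi identity expresses the Ricci form by second derivatives of
`log D`. The Einstein equation then gives `i∂∂̄ log ‖dz₁ ∧ dz₂‖² = λω` (`einstein_const_mul`,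
`iddbar_log_canonicalMetric`), and `c₁(M)` is represented by `(λ/2π) ω`.

The signature is neutral everywhere. By nondegeneracy, being definite of a given sign is an open and
closed condition; on a connected surface a metric that is not definite throughout is therefore
definite nowhere, and the determinant of its Hermitian 2 × 2 matrix is negative
(`hermDet_bilinInChart_neg`).

Plurigenera: let a section `s` of `K^m` be nonzero at a maximum of its norm, with `s = f (dz₁ ∧
dz₂)^m` near that point. On a complex line through it `log |f|` is harmonic, so the Laplacian of
`log ‖dz₁ ∧ dz₂‖²` on that line is at most zero; but in the direction `v` it equals `2λ g(v, v)`. A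
neutral form takes both signs, so some `v` has `λ g(v, v) > 0`, a contradiction
(`pluricanonicalSections_eq_bot`).

Chern number: `ω ∧ ω` is twice the Hermitian determinant times the Euclidean volume form of the
chart, so `(λ/2π)² ω ∧ ω` is negative at every point (`coeff_kahlerForm_wedge`). Any other
representative of `c₁(M)` differs from `(λ/2π) ω` by an exact form, and Stokes' theorem, proved with
a partition of unity, shows that its square has the same integral (`integral_wedge_exact`,
`intersection_self_eq`). -/

theorem Matrix.contDiff_det {ι : Type*} [Fintype ι] [DecidableEq ι] {E : Type*}
    [NormedAddCommGroup E] [NormedSpace ℝ E] {s : Set E} {n : WithTop ℕ∞}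
    {A : E → Matrix ι ι ℝ} (hA : ∀ i j, ContDiffOn ℝ n (fun z => A z i j) s) :
    ContDiffOn ℝ n (fun z => (A z).det) s := by
  simp only [Matrix.det_apply]
  refine ContDiffOn.sum fun σ _ => ?_
  simp only [Units.smul_def, zsmul_eq_mul]
  exact contDiffOn_const.mul (contDiffOn_prod fun i _ => hA _ _)

/-- Jacobi's formula. Factor `A + tH = A (1 + t A⁻¹H)`; the determinant of the second factor is a
polynomial in `t` whose linear coefficient is the trace of `A⁻¹H`. -/
theorem Matrix.hasDerivAt_det_add_smul {ι : Type*} [Fintype ι] [DecidableEq ι]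
    (A H : Matrix ι ι ℝ) (hA : A.det ≠ 0) :
    HasDerivAt (fun t : ℝ => (A + t • H).det) (A.det * (A⁻¹ * H).trace) 0 := by
  have hu : IsUnit A.det := isUnit_iff_ne_zero.mpr hA
  have h1 : (fun t : ℝ => (A + t • H).det) = fun t : ℝ => A.det *
      (1 + (A⁻¹ * H).trace * t +
        (Polynomial.eval t (1 + (Polynomial.X : Polynomial ℝ) •
          (A⁻¹ * H).map Polynomial.C).det.divX.divX) * t ^ 2) := by
    funext t
    rw [← Matrix.det_one_add_smul, ← Matrix.det_mul, mul_add, mul_one, mul_smul_comm,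
      ← Matrix.mul_assoc, Matrix.mul_nonsing_inv _ hu, one_mul]
  rw [h1]
  refine HasDerivAt.const_mul _ ?_
  have h2 : HasDerivAt (fun t : ℝ => (A⁻¹ * H).trace * t) (A⁻¹ * H).trace 0 := by
    simpa using (hasDerivAt_id (0 : ℝ)).const_mul (A⁻¹ * H).trace
  have h3 := (Polynomial.hasDerivAt ((1 + (Polynomial.X : Polynomial ℝ) •
          (A⁻¹ * H).map Polynomial.C).det.divX.divX) (0 : ℝ)).mul
      ((hasDerivAt_id (0 : ℝ)).pow 2)
  have h4 := (h2.const_add 1).add h3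
  have h5 := h4.congr_deriv (f' := _) (g' := (A⁻¹ * H).trace) (by simp)
  refine h5.congr_of_eventuallyEq (Filter.Eventually.of_forall fun t => ?_)
  simp only [Pi.add_apply, Pi.mul_apply, Pi.pow_apply, id]

/-! ### Kähler metrics on an open set: the Levi-Civita connection is complex linear -/

noncomputable section

namespace ComplexSurface

section Local

variable {V : Type*} [NormedAddCommGroup V] [NormedSpace ℝ V]

/-- A Kähler metric `G` on the open set `U`, with respect to the complex structure `I` of `V`. -/
structure IsKahlerOn (I : V →L[ℝ] V) (G : V → V →L[ℝ] V →L[ℝ] ℝ) (U : Set V) : Prop where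
  sq : ∀ v, I (I v) = -v
  isOpen : IsOpen U
  smooth : ContDiffOn ℝ ∞ G U
  symm : ∀ z ∈ U, ∀ v w, G z v w = G z w v
  nondegenerate : ∀ z ∈ U, ∀ v, (∀ w, G z v w = 0) → v = 0
  hermitian : ∀ z ∈ U, ∀ v w, G z (I v) (I w) = G z v w
  closed : ∀ z ∈ U, ∀ u v w,
    fderiv ℝ G z u (I v) w + fderiv ℝ G z v (I w) u + fderiv ℝ G z w (I u) v = 0

/-- The Gram matrix of a bilinear form. -/
def gram {ι : Type*} (b : ι → V) (B : V →L[ℝ] V →L[ℝ] ℝ) : Matrix ι ι ℝ :=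
  Matrix.of fun i j => B (b i) (b j)

namespace IsKahlerOn

variable {I : V →L[ℝ] V} {G : V → V →L[ℝ] V →L[ℝ] ℝ} {U : Set V} {z : V}

theorem contDiffAt (h : IsKahlerOn I G U) (hz : z ∈ U) : ContDiffAt ℝ ∞ G z :=
  h.smooth.contDiffAt (h.isOpen.mem_nhds hz)

theorem differentiableAt (h : IsKahlerOn I G U) (hz : z ∈ U) : DifferentiableAt ℝ G z :=
  (h.contDiffAt hz).differentiableAt (by simp)

theorem hasFDerivAt_apply (h : IsKahlerOn I G U) (hz : z ∈ U) (v w : V) :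
    HasFDerivAt (fun y => G y v w) (((fderiv ℝ G z).flip v).flip w) z := by
  have h1 := ((h.differentiableAt hz).hasFDerivAt.clm_apply (hasFDerivAt_const v z)).clm_apply
    (hasFDerivAt_const w z)
  exact h1.congr_fderiv (by ext u; simp)

theorem fderiv_symm (h : IsKahlerOn I G U) (hz : z ∈ U) (u v w : V) :
    fderiv ℝ G z u v w = fderiv ℝ G z u w v := by
  have h1 := h.hasFDerivAt_apply hz v w
  have h2 := h.hasFDerivAt_apply hz w v
  have h3 : (fun y => G y v w) =ᶠ[𝓝 z] fun y => G y w v := by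
    filter_upwards [h.isOpen.mem_nhds hz] with y hy using h.symm y hy v w
  simpa using DFunLike.congr_fun ((h2.congr_of_eventuallyEq h3).unique h1).symm u

theorem fderiv_hermitian (h : IsKahlerOn I G U) (hz : z ∈ U) (u v w : V) :
    fderiv ℝ G z u (I v) (I w) = fderiv ℝ G z u v w := by
  have h1 := h.hasFDerivAt_apply hz v w
  have h2 := h.hasFDerivAt_apply hz (I v) (I w)
  have h3 : (fun y => G y v w) =ᶠ[𝓝 z] fun y => G y (I v) (I w) := by
    filter_upwards [h.isOpen.mem_nhds hz] with y hy using (h.hermitian y hy v w).symm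
  simpa using DFunLike.congr_fun ((h2.congr_of_eventuallyEq h3).unique h1) u

theorem ext_of_apply (h : IsKahlerOn I G U) (hz : z ∈ U) {v w : V}
    (H : ∀ x, G z v x = G z w x) : v = w :=
  sub_eq_zero.mp (h.nondegenerate z hz _ fun x => by simp [H x])

variable [FiniteDimensional ℝ V]

/-- The metric as an isomorphism onto the dual space. -/
theorem isInvertible (h : IsKahlerOn I G U) (hz : z ∈ U) : (G z).IsInvertible := by
  have hinj : Function.Injective (G z : V →ₗ[ℝ] V →L[ℝ] ℝ) := by
    rw [← LinearMap.ker_eq_bot, LinearMap.ker_eq_bot']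
    intro v hv
    refine h.nondegenerate z hz v fun w => ?_
    have : G z v = 0 := hv
    rw [this]; rfl
  have hfr : Module.finrank ℝ V = Module.finrank ℝ (V →L[ℝ] ℝ) := by
    rw [LinearEquiv.finrank_eq (LinearMap.toContinuousLinearMap (𝕜 := ℝ) (E := V) (F' := ℝ)).symm]
    exact (Subspace.dual_finrank_eq (K := ℝ) (V := V)).symm
  let e := (LinearEquiv.ofInjectiveOfFinrankEq (G z : V →ₗ[ℝ] V →L[ℝ] ℝ) hinj hfr)
  refine ⟨e.toContinuousLinearEquiv, ?_⟩
  ext v w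
  rfl

theorem two_mul_apply_christoffel (h : IsKahlerOn I G U) (hz : z ∈ U) (u v w : V) :
    2 * G z (christoffel G z u v) w =
      fderiv ℝ G z u v w + fderiv ℝ G z v u w - fderiv ℝ G z w u v := by
  have h1 : ∀ S : V →L[ℝ] ℝ, G z ((G z).inverse S) = S := fun S => by
    obtain ⟨e, he⟩ := h.isInvertible hz
    rw [← he, ContinuousLinearMap.inverse_equiv]
    exact e.apply_symm_apply S
  simp only [christoffel, ContinuousLinearMap.comp_apply, ContinuousLinearMap.compL_apply, h1]
  simp

theorem christoffel_symm (h : IsKahlerOn I G U) (hz : z ∈ U) (u v : V) :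
    christoffel G z u v = christoffel G z v u := by
  refine h.ext_of_apply hz fun w => ?_
  have h1 := h.two_mul_apply_christoffel hz u v w
  have h2 := h.two_mul_apply_christoffel hz v u w
  have h3 := h.fderiv_symm hz w u v
  linarith

/-- The Levi-Civita connection of a Kähler metric is complex linear. -/
theorem christoffel_I (h : IsKahlerOn I G U) (hz : z ∈ U) (u v : V) :
    christoffel G z u (I v) = I (christoffel G z u v) := by
  refine h.ext_of_apply hz fun w => ?_
  have h0 : G z (I (christoffel G z u v)) w = - G z (christoffel G z u v) (I w) := by
    have := h.hermitian z hz (I (christoffel G z u v)) w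
    rw [h.sq] at this
    simp at this
    linarith
  have h1 := h.two_mul_apply_christoffel hz u (I v) w
  have h2 := h.two_mul_apply_christoffel hz u v (I w)
  have c1 := h.closed z hz u v w
  have c2 := h.closed z hz u (I v) (I w)
  have hI : ∀ x a b, fderiv ℝ G z x (I a) b = - fderiv ℝ G z x a (I b) := fun x a b => by
    have := h.fderiv_hermitian hz x (I a) b
    rw [h.sq] at this
    simp at this
    linarith
  have s1 := h.fderiv_symm hz v u (I w)
  have s2 := h.fderiv_symm hz w u (I v)
  have s3 := h.fderiv_symm hz (I v) u w
  have i1 := hI u v w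
  have i2 := hI w u v
  simp only [h.sq, h.fderiv_hermitian hz, map_neg, neg_apply] at c2
  linarith

theorem contDiffAt_christoffel (h : IsKahlerOn I G U) (hz : z ∈ U) :
    ContDiffAt ℝ ∞ (christoffel G) z := by
  have hD : ContDiffAt ℝ ∞ (fderiv ℝ G) z := (h.contDiffAt hz).fderiv_right (by simp)
  have hinv : ContDiffAt ℝ ∞ (fun y => (G y).inverse) z := by
    obtain ⟨e, he⟩ := h.isInvertible hz
    have := contDiffAt_map_inverse (𝕜 := ℝ) (n := ∞) e
    rw [he] at this
    exact this.comp z (h.contDiffAt hz)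
  unfold christoffel
  refine ContDiffAt.clm_comp ((ContinuousLinearMap.compL ℝ V (V →L[ℝ] ℝ) V).contDiff.contDiffAt.comp
    z hinv) ?_
  have hflip : ContDiffAt ℝ ∞ (fun y => (fderiv ℝ G y).flip) z :=
    (ContinuousLinearMap.flipₗᵢ ℝ V V (V →L[ℝ] ℝ)).toContinuousLinearEquiv.contDiff.contDiffAt.comp
      z hD
  exact ((hD.add hflip).sub (contDiffAt_const.clm_comp hflip)).const_smul (1 / 2 : ℝ)

theorem hasFDerivAt_christoffel (h : IsKahlerOn I G U) (hz : z ∈ U) :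
    HasFDerivAt (christoffel G) (fderiv ℝ (christoffel G) z) z :=
  ((h.contDiffAt_christoffel hz).differentiableAt (by simp)).hasFDerivAt

theorem hasFDerivAt_christoffel_apply (h : IsKahlerOn I G U) (hz : z ∈ U) (v w : V) :
    HasFDerivAt (fun y => christoffel G y v w)
      (((fderiv ℝ (christoffel G) z).flip v).flip w) z := by
  have h1 := ((h.hasFDerivAt_christoffel hz).clm_apply (hasFDerivAt_const v z)).clm_apply
    (hasFDerivAt_const w z)
  exact h1.congr_fderiv (by ext u; simp)

theorem fderiv_christoffel_symm (h : IsKahlerOn I G U) (hz : z ∈ U) (u v w : V) :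
    fderiv ℝ (christoffel G) z u v w = fderiv ℝ (christoffel G) z u w v := by
  have h1 := h.hasFDerivAt_christoffel_apply hz v w
  have h2 := h.hasFDerivAt_christoffel_apply hz w v
  have h3 : (fun y => christoffel G y v w) =ᶠ[𝓝 z] fun y => christoffel G y w v := by
    filter_upwards [h.isOpen.mem_nhds hz] with y hy using h.christoffel_symm hy v w
  simpa using DFunLike.congr_fun ((h2.congr_of_eventuallyEq h3).unique h1).symm u

theorem fderiv_christoffel_I (h : IsKahlerOn I G U) (hz : z ∈ U) (u v w : V) :
    fderiv ℝ (christoffel G) z u v (I w) = I (fderiv ℝ (christoffel G) z u v w) := by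
  have h1 := h.hasFDerivAt_christoffel_apply hz v (I w)
  have h2 := I.hasFDerivAt.comp z (h.hasFDerivAt_christoffel_apply hz v w)
  have h3 : (fun y => christoffel G y v (I w)) =ᶠ[𝓝 z] fun y => I (christoffel G y v w) := by
    filter_upwards [h.isOpen.mem_nhds hz] with y hy using h.christoffel_I hy v w
  simpa using DFunLike.congr_fun ((h2.congr_of_eventuallyEq h3).unique h1).symm u

end IsKahlerOn

end Local
end ComplexSurface
end

/-- The determinant is a polynomial, hence differentiable, so its derivative can be read off along
lines, where Jacobi's formula applies. -/
theorem Matrix.hasFDerivAt_det {ι : Type*} [Fintype ι] [DecidableEq ι] {E : Type*}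
    [NormedAddCommGroup E] [NormedSpace ℝ E] {A : E → Matrix ι ι ℝ} {A' : E →L[ℝ] (ι → ι → ℝ)}
    {z : E} (hA : HasFDerivAt (fun y i j => A y i j) A' z) (hdet : (A z).det ≠ 0) :
    ∃ L : E →L[ℝ] ℝ, HasFDerivAt (fun y => (A y).det) L z ∧
      ∀ u, L u = (A z).det * ((A z)⁻¹ * Matrix.of (A' u)).trace := by
  let d : (ι → ι → ℝ) → ℝ := fun B => (Matrix.of B).det
  have hd : ContDiff ℝ 1 d := by
    rw [← contDiffOn_univ]
    exact Matrix.contDiff_det fun i j => by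
      simp only [Matrix.of_apply]; fun_prop
  have hd1 := (hd.differentiable (by simp) (fun i j => A z i j)).hasFDerivAt
  refine ⟨(fderiv ℝ d (fun i j => A z i j)).comp A', hd1.comp z hA, fun u => ?_⟩
  have h1 : HasDerivAt (fun t : ℝ => (fun i j => A z i j) + t • A' u) (A' u) 0 := by
    simpa using ((hasDerivAt_id (0 : ℝ)).smul_const (A' u)).const_add (fun i j => A z i j)
  have h2 : HasDerivAt (fun t : ℝ => d ((fun i j => A z i j) + t • A' u))
      (fderiv ℝ d (fun i j => A z i j) (A' u)) 0 :=
    HasFDerivAt.comp_hasDerivAt (0 : ℝ) (by rw [zero_smul, add_zero]; exact hd1) h1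
  exact h2.unique (Matrix.hasDerivAt_det_add_smul (A z) (Matrix.of (A' u)) hdet)

theorem Matrix.trace_mul_eq_zero_of_antisymm {ι : Type*} [Fintype ι] (A N : Matrix ι ι ℝ)
    (hA : A.transpose = A) (hN : N.transpose = -N) : (A * N).trace = 0 := by
  have h : (A * N).trace = -(A * N).trace := by
    conv_lhs => rw [← Matrix.trace_transpose, Matrix.transpose_mul, hA, hN, Matrix.neg_mul,
      Matrix.trace_neg, Matrix.trace_mul_comm]
  linarith

/-! ### Ricci curvature and the logarithm of the volume density -/

noncomputable section
namespace ComplexSurface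
section Local
variable {V : Type*} [NormedAddCommGroup V] [NormedSpace ℝ V]
variable {ι : Type*} [Fintype ι] [DecidableEq ι]

/-- A vector in the kernel of the Gram matrix is the coordinate vector of an element orthogonal to
all basis vectors. -/
theorem det_gram_ne_zero (b : Module.Basis ι ℝ V) {B : V →L[ℝ] V →L[ℝ] ℝ}
    (hs : ∀ v w, B v w = B w v)
    (hB : ∀ v, (∀ w, B v w = 0) → v = 0) : (gram b B).det ≠ 0 := by
  intro h0
  obtain ⟨c, hc, hc0⟩ := Matrix.exists_mulVec_eq_zero_iff.mpr h0
  refine hc ?_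
  have h1 : ∑ j, c j • b j = 0 := by
    refine hB _ fun w => ?_
    rw [← b.sum_repr w]
    simp only [map_sum, map_smul]
    refine Finset.sum_eq_zero fun i _ => ?_
    have h2 := congrFun hc0 i
    simp only [Matrix.mulVec, dotProduct, gram, Matrix.of_apply, Pi.zero_apply] at h2
    simp only [_root_.sum_apply, smul_apply, hs _ (b i), smul_eq_mul]
    rw [mul_eq_zero]; right
    rw [← h2]
    exact Finset.sum_congr rfl fun j _ => mul_comm _ _
  funext j
  exact Fintype.linearIndependent_iff.mp b.linearIndependent c h1 j

namespace IsKahlerOn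

variable {I : V →L[ℝ] V} {G : V → V →L[ℝ] V →L[ℝ] ℝ} {U : Set V} {z : V}
variable [FiniteDimensional ℝ V]

/-- Lowering an index, the Koszul formula splits `2 Γ_u` into `∂_u G` and a part `K` antisymmetric
in the two remaining arguments. The inverse Gram matrix is symmetric, so its product with `K` is
traceless. -/
theorem trace_christoffel (h : IsKahlerOn I G U) (hz : z ∈ U) (b : Module.Basis ι ℝ V) (u : V) :
    2 * LinearMap.trace ℝ V (christoffel G z u : V →ₗ[ℝ] V) =
      ((gram b (G z))⁻¹ * gram b (fderiv ℝ G z u)).trace := by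
  set A := gram b (G z)
  have hdet : IsUnit A.det :=
    isUnit_iff_ne_zero.mpr (det_gram_ne_zero b (h.symm z hz) (h.nondegenerate z hz))
  set N := LinearMap.toMatrix b b (christoffel G z u : V →ₗ[ℝ] V)
  let K : Matrix ι ι ℝ := Matrix.of fun i j => fderiv ℝ G z (b j) u (b i) - fderiv ℝ G z (b i) u (b j)
  have hAN : (2 : ℝ) • (A * N) = gram b (fderiv ℝ G z u) + K := by
    ext i j
    have h1 : (A * N) i j = G z (christoffel G z u (b j)) (b i) := by
      conv_rhs => rw [← b.sum_repr (christoffel G z u (b j))]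
      simp only [map_sum, map_smul, _root_.sum_apply, smul_apply, Matrix.mul_apply, A, N, gram,
        Matrix.of_apply, LinearMap.toMatrix_apply]
      exact Finset.sum_congr rfl fun k _ => by
        rw [h.symm z hz (b i)]; simp [mul_comm]
    have h2 := h.two_mul_apply_christoffel hz u (b j) (b i)
    rw [Matrix.smul_apply, h1, smul_eq_mul, h2]
    simp only [gram, K, Matrix.add_apply, Matrix.of_apply]
    rw [h.fderiv_symm hz u (b j)]
    ring
  have hA : A.transpose = A := by
    ext i j
    exact h.symm z hz _ _
  have hAi : (A⁻¹).transpose = A⁻¹ := by rw [Matrix.transpose_nonsing_inv, hA]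
  have hK : K.transpose = -K := by
    ext i j
    simp [K]
  have hN : (2 : ℝ) • N = A⁻¹ * gram b (fderiv ℝ G z u) + A⁻¹ * K := by
    rw [← Matrix.mul_add, ← hAN, Matrix.mul_smul, ← Matrix.mul_assoc, Matrix.nonsing_inv_mul _ hdet,
      Matrix.one_mul]
  rw [LinearMap.trace_eq_matrix_trace ℝ b]
  have := congrArg Matrix.trace hN
  rw [Matrix.trace_smul, Matrix.trace_add, Matrix.trace_mul_eq_zero_of_antisymm _ _ hAi hK,
    add_zero] at this
  exact this

/-- The derivative of the logarithm of the volume density of a metric. -/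
theorem hasFDerivAt_log_det (h : IsKahlerOn I G U) (hz : z ∈ U) (b : Module.Basis ι ℝ V) :
    ∃ L : V →L[ℝ] ℝ, HasFDerivAt (fun y => Real.log (gram b (G y)).det) L z ∧
      ∀ u, L u = 2 * LinearMap.trace ℝ V (christoffel G z u : V →ₗ[ℝ] V) := by
  have hne := det_gram_ne_zero b (h.symm z hz) (h.nondegenerate z hz)
  let A' : V →L[ℝ] (ι → ι → ℝ) := ContinuousLinearMap.pi fun i => ContinuousLinearMap.pi fun j =>
    (((fderiv ℝ G z).flip (b i)).flip (b j))
  have hA' : HasFDerivAt (fun y i j => gram b (G y) i j) A' z := by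
    rw [hasFDerivAt_pi]
    intro i
    rw [hasFDerivAt_pi]
    intro j
    exact h.hasFDerivAt_apply hz (b i) (b j)
  obtain ⟨L, hL, hLu⟩ := Matrix.hasFDerivAt_det hA' hne
  refine ⟨_, hL.log hne, fun u => ?_⟩
  rw [h.trace_christoffel hz b, smul_apply, hLu, smul_eq_mul,
    inv_mul_cancel_left₀ hne]
  rfl

omit [FiniteDimensional ℝ V] in
theorem contDiffOn_det (h : IsKahlerOn I G U) (b : Module.Basis ι ℝ V) :
    ContDiffOn ℝ ∞ (fun y => (gram b (G y)).det) U :=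
  Matrix.contDiff_det fun _ _ => (h.smooth.clm_apply contDiffOn_const).clm_apply contDiffOn_const

omit [FiniteDimensional ℝ V] in
theorem contDiffOn_log_det (h : IsKahlerOn I G U) (b : Module.Basis ι ℝ V) :
    ContDiffOn ℝ ∞ (fun y => Real.log (gram b (G y)).det) U :=
  (h.contDiffOn_det b).log fun y hy => det_gram_ne_zero b (h.symm y hy) (h.nondegenerate y hy)

theorem fderiv_log_det (h : IsKahlerOn I G U) (hz : z ∈ U) (b : Module.Basis ι ℝ V) (u : V) :
    fderiv ℝ (fun y => Real.log (gram b (G y)).det) z u =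
      2 * LinearMap.trace ℝ V (christoffel G z u : V →ₗ[ℝ] V) := by
  obtain ⟨L, hL, hLu⟩ := h.hasFDerivAt_log_det hz b
  rw [hL.fderiv, hLu]

/-- The trace, as a continuous linear map on endomorphisms. -/
def traceCLM : (V →L[ℝ] V) →L[ℝ] ℝ :=
  LinearMap.toContinuousLinearMap (LinearMap.trace ℝ V ∘ₗ ContinuousLinearMap.coeLM ℝ)

theorem traceCLM_apply (A : V →L[ℝ] V) : traceCLM A = LinearMap.trace ℝ V (A : V →ₗ[ℝ] V) := rfl

theorem traceCLM_comp_comm (A B : V →L[ℝ] V) : traceCLM (A ∘L B) = traceCLM (B ∘L A) :=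
  LinearMap.trace_mul_comm ℝ (A : V →ₗ[ℝ] V) (B : V →ₗ[ℝ] V)

/-- Symmetry and complex linearity of the connection give `I Γ_w = Γ_{Iw}`, whose trace is half the
derivative of `log D` along `Iw`. -/
theorem traceCLM_I_comp_christoffel (h : IsKahlerOn I G U) (hz : z ∈ U) (b : Module.Basis ι ℝ V)
    (w : V) : traceCLM (I ∘L christoffel G z w) =
      (1 / 2) * fderiv ℝ (fun y => Real.log (gram b (G y)).det) z (I w) := by
  have : I ∘L christoffel G z w = christoffel G z (I w) := by
    ext u
    rw [ContinuousLinearMap.comp_apply, h.christoffel_symm hz, ← h.christoffel_I hz,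
      h.christoffel_symm hz]
  rw [h.fderiv_log_det hz b, this, traceCLM_apply]
  ring

/-- The preceding identity holds near `z`, so it can be differentiated along `v`. -/
theorem traceCLM_I_comp_fderiv_christoffel (h : IsKahlerOn I G U) (hz : z ∈ U)
    (b : Module.Basis ι ℝ V) (v w : V) :
    traceCLM (I ∘L fderiv ℝ (christoffel G) z v w) =
      (1 / 2) * fderiv ℝ (fderiv ℝ fun y => Real.log (gram b (G y)).det) z v (I w) := by
  let f := fun y => Real.log (gram b (G y)).det
  have hf : DifferentiableAt ℝ (fderiv ℝ f) z :=
    (((h.contDiffOn_log_det b).contDiffAt (h.isOpen.mem_nhds hz)).fderiv_right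
      (m := 1) (by exact WithTop.coe_le_coe.mpr le_top)).differentiableAt (by simp)
  have h1 : HasFDerivAt (fun y => (1 / 2 : ℝ) * fderiv ℝ f y (I w))
      ((1 / 2 : ℝ) • (fderiv ℝ (fderiv ℝ f) z).flip (I w)) z := by
    refine HasFDerivAt.const_mul ?_ _
    exact (hf.hasFDerivAt.clm_apply (hasFDerivAt_const (I w) z)).congr_fderiv (by ext; simp)
  have h2 : HasFDerivAt (fun y => traceCLM (I ∘L christoffel G y w))
      (traceCLM ∘L ((ContinuousLinearMap.compL ℝ V V V I) ∘L
        (fderiv ℝ (christoffel G) z).flip w)) z := by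
    refine traceCLM.hasFDerivAt.comp z ((ContinuousLinearMap.compL ℝ V V V I).hasFDerivAt.comp z ?_)
    exact ((h.hasFDerivAt_christoffel hz).clm_apply (hasFDerivAt_const w z)).congr_fderiv
      (by ext; simp)
  have h3 : (fun y => traceCLM (I ∘L christoffel G y w)) =ᶠ[𝓝 z]
      fun y => (1 / 2 : ℝ) * fderiv ℝ f y (I w) := by
    filter_upwards [h.isOpen.mem_nhds hz] with y hy using h.traceCLM_I_comp_christoffel hy b w
  have := DFunLike.congr_fun ((h1.congr_of_eventuallyEq h3).unique h2).symm v
  simpa [f] using this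

/-- By the first Bianchi identity and complex linearity, `R(u, v) Iw - R(u, w) Iv = I R(w, v) u`. In
the trace over `u` the quadratic terms of `I R(w, v)` form a commutator and drop out; only
derivatives of `tr (I Γ)` remain, and these are second derivatives of `log D`. -/
theorem ricci_sub_ricci (h : IsKahlerOn I G U) (hz : z ∈ U) (b : Module.Basis ι ℝ V) (v w : V) :
    ricci G z v (I w) - ricci G z w (I v) =
      -(1 / 2) * (fderiv ℝ (fderiv ℝ fun y => Real.log (gram b (G y)).det) z v (I w) -
        fderiv ℝ (fderiv ℝ fun y => Real.log (gram b (G y)).det) z w (I v)) := by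
  set Γ := christoffel G z with hΓ
  set D := fderiv ℝ (christoffel G) z with hD
  have key : curvatureEnd G z v (I w) - curvatureEnd G z w (I v) =
      I ∘L D w v - I ∘L D v w + ((I ∘L Γ w) ∘L Γ v - Γ v ∘L (I ∘L Γ w)) := by
    ext u
    simp only [curvatureEnd, ← hΓ, ← hD, sub_apply, add_apply, ContinuousLinearMap.comp_apply,
      ContinuousLinearMap.flip_apply]
    simp only [hΓ, hD, h.fderiv_christoffel_I hz, h.christoffel_I hz]
    rw [h.fderiv_christoffel_symm hz u v w, h.fderiv_christoffel_symm hz v u w,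
      h.fderiv_christoffel_symm hz w u v, h.christoffel_symm hz v w,
      h.christoffel_symm hz u w, h.christoffel_symm hz u v]
    abel
  have h1 : ricci G z v (I w) - ricci G z w (I v) =
      traceCLM (curvatureEnd G z v (I w) - curvatureEnd G z w (I v)) := by
    rw [map_sub]; rfl
  rw [h1, key, map_add, map_sub, map_sub, traceCLM_comp_comm (I ∘L Γ w) (Γ v), sub_self,
    h.traceCLM_I_comp_fderiv_christoffel hz b, h.traceCLM_I_comp_fderiv_christoffel hz b]
  ring

/-- For a Kähler-Einstein metric, the Kähler form is a multiple of `i∂∂̄` of the logarithm of the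
volume density. -/
theorem einstein_const_mul (h : IsKahlerOn I G U) (hz : z ∈ U) (b : Module.Basis ι ℝ V) {lam : ℝ}
    (hE : ∀ v w, ricci G z v w = lam * G z v w) (v w : V) :
    lam * G z (I v) w =
      (1 / 4) * (fderiv ℝ (fderiv ℝ fun y => Real.log (gram b (G y)).det) z v (I w) -
        fderiv ℝ (fderiv ℝ fun y => Real.log (gram b (G y)).det) z w (I v)) := by
  have h1 := h.ricci_sub_ricci hz b v w
  rw [hE, hE, h.symm z hz w] at h1
  have h2 := h.hermitian z hz v (I w)
  rw [h.sq, map_neg] at h2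
  rw [← h2] at h1
  linarith

end IsKahlerOn
end Local
end ComplexSurface
end

noncomputable section
namespace ComplexSurface

/-! ### Charts of a complex surface -/

section Charts

/-- Forms and metrics are pulled back by real derivatives, while the charts are holomorphic. This
makes the two kinds of derivative agree, so that the real derivative of a chart commutes with
`mulI`. -/
theorem _root_.HasMFDerivAt.restrictScalars_real {E E' : Type*} [NormedAddCommGroup E]
    [NormedSpace ℂ E] [NormedAddCommGroup E'] [NormedSpace ℂ E'] {M M' : Type*}
    [TopologicalSpace M] [ChartedSpace E M] [TopologicalSpace M'] [ChartedSpace E' M']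
    {f : M → M'} {x : M} {A : E →L[ℂ] E'} (h : HasMFDerivAt 𝓘(ℂ, E) 𝓘(ℂ, E') f x A) :
    HasMFDerivAt 𝓘(ℝ, E) 𝓘(ℝ, E') f x (A.restrictScalars ℝ) :=
  ⟨h.1, HasFDerivWithinAt.restrictScalars ℝ h.2⟩

variable {M : Type*} [TopologicalSpace M] [ChartedSpace C2 M] [IsManifold 𝓘(ℂ, C2) ω M]
variable {e e' : OpenPartialHomeomorph M C2} {z : C2}

/-- The complex derivative of the inverse of a chart. -/
def chartDeriv (e : OpenPartialHomeomorph M C2) (z : C2) : C2 →L[ℂ] C2 :=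
  mfderiv 𝓘(ℂ, C2) 𝓘(ℂ, C2) e.symm z

/-- The complex derivative of a coordinate change. -/
def transDeriv (e e' : OpenPartialHomeomorph M C2) (z : C2) : C2 →L[ℂ] C2 :=
  (mfderiv 𝓘(ℂ, C2) 𝓘(ℂ, C2) e' (e.symm z) : C2 →L[ℂ] C2) ∘L chartDeriv e z

theorem hasMFDerivAt_symm (he : e ∈ atlas C2 M) (hz : z ∈ e.target) :
    HasMFDerivAt 𝓘(ℂ, C2) 𝓘(ℂ, C2) e.symm z (chartDeriv e z) :=
  (mdifferentiableAt_atlas_symm he hz).hasMFDerivAt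

theorem mfderiv_symm (he : e ∈ atlas C2 M) (hz : z ∈ e.target) :
    (mfderiv 𝓘(ℝ, C2) 𝓘(ℝ, C2) e.symm z : C2 →L[ℝ] C2) = (chartDeriv e z).restrictScalars ℝ :=
  (hasMFDerivAt_symm he hz).restrictScalars_real.mfderiv

theorem mfderiv_comp_chartDeriv (he : e ∈ atlas C2 M) (hz : z ∈ e.target) :
    (mfderiv 𝓘(ℂ, C2) 𝓘(ℂ, C2) e (e.symm z) : C2 →L[ℂ] C2) ∘L chartDeriv e z =
      ContinuousLinearMap.id ℂ C2 :=
  (mdifferentiable_of_mem_atlas he).comp_symm_deriv hz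

theorem chartDeriv_surjective (he : e ∈ atlas C2 M) (hz : z ∈ e.target) :
    Function.Surjective (chartDeriv e z) :=
  ((mdifferentiable_of_mem_atlas he).symm).mfderiv_surjective (I := 𝓘(ℂ, C2)) (I' := 𝓘(ℂ, C2)) hz

theorem chartDeriv_injective (he : e ∈ atlas C2 M) (hz : z ∈ e.target) :
    Function.Injective (chartDeriv e z) :=
  ((mdifferentiable_of_mem_atlas he).symm).mfderiv_injective (I := 𝓘(ℂ, C2)) (I' := 𝓘(ℂ, C2)) hz

theorem det_chartDeriv_ne_zero (he : e ∈ atlas C2 M) (hz : z ∈ e.target) :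
    LinearMap.det (chartDeriv e z : C2 →ₗ[ℂ] C2) ≠ 0 := fun h0 =>
  (LinearMap.bot_lt_ker_of_det_eq_zero h0).ne'
    (LinearMap.ker_eq_bot.mpr (chartDeriv_injective he hz))

theorem hasFDerivAt_trans (he : e ∈ atlas C2 M) (he' : e' ∈ atlas C2 M) (hz : z ∈ e.target)
    (hz' : e.symm z ∈ e'.source) :
    HasFDerivAt (fun y => e' (e.symm y)) (transDeriv e e' z) z := by
  have h1 : HasMFDerivAt 𝓘(ℂ, C2) 𝓘(ℂ, C2) e' (e.symm z) _ :=
    (mdifferentiableAt_atlas he' hz').hasMFDerivAt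
  exact (h1.comp z (hasMFDerivAt_symm he hz)).hasFDerivAt

omit [ChartedSpace C2 M] [IsManifold 𝓘(ℂ, C2) ω M] in
theorem eventually_mem_source (hz : z ∈ e.target) (hz' : e.symm z ∈ e'.source) :
    ∀ᶠ y in 𝓝 z, y ∈ e.target ∧ e.symm y ∈ e'.source :=
  ((e.open_target.mem_nhds hz |> Filter.eventually_of_mem) fun _ h => h).and
    ((e.continuousAt_symm hz).eventually (e'.open_source.mem_nhds hz'))

theorem chartDeriv_trans (he : e ∈ atlas C2 M) (he' : e' ∈ atlas C2 M) (hz : z ∈ e.target)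
    (hz' : e.symm z ∈ e'.source) :
    chartDeriv e z = chartDeriv e' (e' (e.symm z)) ∘L transDeriv e e' z := by
  have h1 := (hasFDerivAt_trans he he' hz hz').hasMFDerivAt
  have h2 : HasMFDerivAt 𝓘(ℂ, C2) 𝓘(ℂ, C2) e'.symm (e' (e.symm z)) _ :=
    hasMFDerivAt_symm he' (e'.map_source hz')
  have h3 := h2.comp z h1
  refine HasMFDerivAt.mfderiv (h3.congr_of_eventuallyEq ?_)
  filter_upwards [eventually_mem_source hz hz'] with y hy
  simp [e'.left_inv hy.2]

/-- The real determinant is the norm, for `ℂ` over `ℝ`, of the complex determinant. Its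
nonnegativity is why holomorphic coordinate changes preserve orientation. -/
theorem det_restrictScalars_C2 (A : C2 →L[ℂ] C2) :
    LinearMap.det ((A.restrictScalars ℝ : C2 →L[ℝ] C2) : C2 →ₗ[ℝ] C2) =
      ‖LinearMap.det (A : C2 →ₗ[ℂ] C2)‖ ^ 2 := by
  have := LinearMap.det_restrictScalars (R := ℝ) (S := ℂ) (f := (A : C2 →ₗ[ℂ] C2))
  rw [← Complex.normSq_eq_norm_sq, ← Algebra.norm_complex_apply]
  exact this

end Charts
end ComplexSurface
end

/-! ### Forms of low degree and the metric in a chart -/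

noncomputable section
namespace ComplexSurface

theorem mulI_apply (v : C2) : mulI v = Complex.I • v := rfl

theorem mulI_mulI (v : C2) : mulI (mulI v) = -v := by
  rw [mulI_apply, mulI_apply, smul_smul, Complex.I_mul_I, neg_one_smul]

/-- Covectors as forms of degree one. -/
def oneForm : (C2 →L[ℝ] ℝ) →L[ℝ] C2 [⋀^Fin 1]→L[ℝ] ℝ :=
  (ContinuousAlternatingMap.ofSubsingletonLIE (𝕜 := ℝ) (E := C2) (F := ℝ)
    (0 : Fin 1)).toContinuousLinearEquiv.toContinuousLinearMap

theorem oneForm_apply (L : C2 →L[ℝ] ℝ) (v : Fin 1 → C2) : oneForm L v = L (v 0) := rfl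

/-- The 2-form `(v, w) ↦ B v w - B w v` defined by a bilinear form `B`. -/
def twoForm : (C2 →L[ℝ] C2 →L[ℝ] ℝ) →L[ℝ] C2 [⋀^Fin 2]→L[ℝ] ℝ :=
  ContinuousAlternatingMap.alternatizeUncurryFinCLM ℝ C2 ℝ ∘L
    ContinuousLinearMap.compL ℝ C2 (C2 →L[ℝ] ℝ) (C2 [⋀^Fin 1]→L[ℝ] ℝ) oneForm

theorem twoForm_apply (B : C2 →L[ℝ] C2 →L[ℝ] ℝ) (v : Fin 2 → C2) :
    twoForm B v = B (v 0) (v 1) - B (v 1) (v 0) := by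
  simp only [twoForm, ContinuousLinearMap.comp_apply,
    ContinuousAlternatingMap.alternatizeUncurryFinCLM_apply,
    ContinuousAlternatingMap.alternatizeUncurryFin_apply, ContinuousLinearMap.compL_apply,
    oneForm_apply]
  simp [Fin.removeNth, sub_eq_add_neg]

theorem extDeriv_apply_one {V : Type*} [NormedAddCommGroup V] [NormedSpace ℝ V]
    {α : V → V [⋀^Fin 1]→L[ℝ] ℝ} {z : V} (h : DifferentiableAt ℝ α z) (v : Fin 2 → V) :
    extDeriv α z v = fderiv ℝ (fun y => α y fun _ => v 1) z (v 0) -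
      fderiv ℝ (fun y => α y fun _ => v 0) z (v 1) := by
  rw [extDeriv_apply h, Fin.sum_univ_two]
  have h0 : (0 : Fin 2).removeNth v = fun _ => v 1 := by
    ext i; fin_cases i; rfl
  have h1 : (1 : Fin 2).removeNth v = fun _ => v 0 := by
    ext i; fin_cases i; rfl
  rw [h0, h1]
  simp [sub_eq_add_neg]

theorem extDeriv_apply_two {V : Type*} [NormedAddCommGroup V] [NormedSpace ℝ V]
    {α : V → V [⋀^Fin 2]→L[ℝ] ℝ} {z : V} (h : DifferentiableAt ℝ α z) (v : Fin 3 → V) :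
    extDeriv α z v = fderiv ℝ (fun y => α y ![v 1, v 2]) z (v 0) -
      fderiv ℝ (fun y => α y ![v 0, v 2]) z (v 1) + fderiv ℝ (fun y => α y ![v 0, v 1]) z (v 2) := by
  rw [extDeriv_apply h, Fin.sum_univ_three]
  have h0 : (0 : Fin 3).removeNth v = ![v 1, v 2] := by
    ext i : 1; fin_cases i <;> rfl
  have h1 : (1 : Fin 3).removeNth v = ![v 0, v 2] := by
    ext i : 1; fin_cases i <;> rfl
  have h2 : (2 : Fin 3).removeNth v = ![v 0, v 1] := by
    ext i : 1; fin_cases i <;> rfl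
  rw [h0, h1, h2]
  simp [sub_eq_add_neg]

theorem _root_.AlternatingMap.map_pair_swap {V : Type*} [AddCommGroup V] [Module ℝ V]
    (α : V [⋀^Fin 2]→ₗ[ℝ] ℝ) (u w : V) : α ![u, w] = -α ![w, u] := by
  have h := α.map_swap ![w, u] (i := 0) (j := 1) (by simp)
  have h2 : ![w, u] ∘ Equiv.swap (0 : Fin 2) 1 = ![u, w] := by
    ext i : 1
    fin_cases i <;> simp
  rwa [h2] at h

theorem dc_apply (f : C2 → ℝ) (z : C2) (v : Fin 1 → C2) :
    dc f z v = -(fderiv ℝ f z (mulI (v 0))) := rfl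

theorem contDiffAt_dc {f : C2 → ℝ} {z : C2} {n : WithTop ℕ∞} (hf : ContDiffAt ℝ (n + 1) f z) :
    ContDiffAt ℝ n (dc f) z := by
  have h1 : ContDiffAt ℝ n (fun y => -(fderiv ℝ f y ∘L mulI)) z :=
    ((hf.fderiv_right le_rfl).clm_comp contDiffAt_const).neg
  exact oneForm.contDiff.contDiffAt.comp z h1

theorem hasFDerivAt_fderiv_apply {V : Type*} [NormedAddCommGroup V] [NormedSpace ℝ V] {f : V → ℝ}
    {z : V} (hf : ContDiffAt ℝ 2 f z) (v : V) :
    HasFDerivAt (fun y => fderiv ℝ f y v) ((fderiv ℝ (fderiv ℝ f) z).flip v) z := by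
  have h1 : DifferentiableAt ℝ (fderiv ℝ f) z :=
    (hf.fderiv_right (m := 1) (by norm_num [one_add_one_eq_two])).differentiableAt (by simp)
  exact (h1.hasFDerivAt.clm_apply (hasFDerivAt_const v z)).congr_fderiv (by ext; simp)

/-- Expresses `i∂∂̄ f` by the Hessian of `f`, which is the shape in which the Einstein equation is
available. -/
theorem iddbar_apply {f : C2 → ℝ} {z : C2} (hf : ContDiffAt ℝ 2 f z) (v : Fin 2 → C2) :
    iddbar f z v = (1 / 2) * (fderiv ℝ (fderiv ℝ f) z (v 1) (mulI (v 0)) -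
      fderiv ℝ (fderiv ℝ f) z (v 0) (mulI (v 1))) := by
  have h1 : DifferentiableAt ℝ (dc f) z :=
    (contDiffAt_dc (n := 1) (by simpa [one_add_one_eq_two] using hf)).differentiableAt (by simp)
  simp only [iddbar, ContinuousAlternatingMap.smul_apply, extDeriv_apply_one h1, dc_apply,
    smul_eq_mul]
  rw [(hasFDerivAt_fderiv_apply hf (mulI (v 1))).fun_neg.fderiv,
    (hasFDerivAt_fderiv_apply hf (mulI (v 0))).fun_neg.fderiv]
  simp only [neg_apply, ContinuousLinearMap.flip_apply]
  ring

section Metric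

variable {M : Type*} [TopologicalSpace M] [ChartedSpace C2 M] [IsManifold 𝓘(ℂ, C2) ω M]
variable {e e' : OpenPartialHomeomorph M C2} {z : C2}

theorem RawForm.inChart_apply {k : ℕ} (η : RawForm M k) (he : e ∈ atlas C2 M) (hz : z ∈ e.target)
    (v : Fin k → C2) :
    η.inChart e z v = η (e.symm z) (fun i => chartDeriv e z (v i)) := by
  have h1 : η.inChart e z v = η (e.symm z)
    (fun i => (mfderiv 𝓘(ℝ, C2) 𝓘(ℝ, C2) e.symm z : C2 →L[ℝ] C2) (v i)) := rfl
  rw [h1, mfderiv_symm he hz]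
  rfl

theorem bilinInChart_apply (B : ∀ x : M, T x →L[ℝ] T x →L[ℝ] ℝ) (he : e ∈ atlas C2 M)
    (hz : z ∈ e.target) (v w : C2) :
    bilinInChart B e z v w = B (e.symm z) (chartDeriv e z v) (chartDeriv e z w) := by
  have h1 : bilinInChart B e z v w = B (e.symm z)
    ((mfderiv 𝓘(ℝ, C2) 𝓘(ℝ, C2) e.symm z : C2 →L[ℝ] C2) v)
    ((mfderiv 𝓘(ℝ, C2) 𝓘(ℝ, C2) e.symm z : C2 →L[ℝ] C2) w) := rfl
  rw [h1, mfderiv_symm he hz]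
  rfl

omit [IsManifold 𝓘(ℂ, C2) ω M] in
theorem chartDeriv_mulI (e : OpenPartialHomeomorph M C2) (z v : C2) :
    chartDeriv e z (mulI v) = mulI (chartDeriv e z v) :=
  (chartDeriv e z).map_smul Complex.I v

namespace HermitianPseudoMetric

variable (g : HermitianPseudoMetric M)

theorem kahlerForm_inChart_apply (he : e ∈ atlas C2 M) (hz : z ∈ e.target) (v : Fin 2 → C2) :
    g.kahlerForm.inChart e z v = bilinInChart g.toFun e z (mulI (v 0)) (v 1) := by
  rw [RawForm.inChart_apply _ he hz, bilinInChart_apply _ he hz, chartDeriv_mulI]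
  rfl

theorem bilinInChart_symm (he : e ∈ atlas C2 M) (hz : z ∈ e.target) (v w : C2) :
    bilinInChart g.toFun e z v w = bilinInChart g.toFun e z w v := by
  rw [bilinInChart_apply _ he hz, bilinInChart_apply _ he hz]
  exact g.symm _ _ _

theorem bilinInChart_mulI (he : e ∈ atlas C2 M) (hz : z ∈ e.target) (v w : C2) :
    bilinInChart g.toFun e z (mulI v) (mulI w) = bilinInChart g.toFun e z v w := by
  rw [bilinInChart_apply _ he hz, bilinInChart_apply _ he hz, chartDeriv_mulI, chartDeriv_mulI]
  exact g.hermitian _ _ _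

theorem bilinInChart_nondegenerate (he : e ∈ atlas C2 M) (hz : z ∈ e.target) (v : C2)
    (h : ∀ w, bilinInChart g.toFun e z v w = 0) : v = 0 := by
  refine chartDeriv_injective he hz ?_
  rw [map_zero]
  refine g.nondegenerate (e.symm z) _ fun w => ?_
  obtain ⟨w', rfl⟩ := chartDeriv_surjective he hz w
  rw [← bilinInChart_apply _ he hz]
  exact h w'

/-- The bilinear form `G(I·, ·)` is already alternating, hence equal to half of its alternatization,
and `twoForm` is continuous linear. -/
theorem contDiffOn_kahlerForm (he : e ∈ atlas C2 M) :
    ContDiffOn ℝ ∞ (g.kahlerForm.inChart e) e.target := by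
  have h1 : ContDiffOn ℝ ∞ (fun y => (1 / 2 : ℝ) •
      twoForm (bilinInChart g.toFun e y ∘L mulI)) e.target :=
    (twoForm.contDiff.comp_contDiffOn ((g.smooth e he).clm_comp contDiffOn_const)).const_smul _
  refine h1.congr fun y hy => ?_
  ext v
  rw [g.kahlerForm_inChart_apply he hy]
  simp only [ContinuousAlternatingMap.smul_apply, twoForm_apply, ContinuousLinearMap.comp_apply,
    smul_eq_mul]
  have := g.bilinInChart_mulI he hy (mulI (v 1)) (v 0)
  rw [mulI_mulI, map_neg, neg_apply, g.bilinInChart_symm he hy (v 1)] at this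
  linarith

theorem isKahlerOn (hK : g.IsKahler) (he : e ∈ atlas C2 M) :
    IsKahlerOn mulI (bilinInChart g.toFun e) e.target where
  sq := mulI_mulI
  isOpen := e.open_target
  smooth := g.smooth e he
  symm z hz := g.bilinInChart_symm he hz
  nondegenerate z hz := g.bilinInChart_nondegenerate he hz
  hermitian z hz := g.bilinInChart_mulI he hz
  closed z hz u v w := by
    have h1 := hK e he z hz
    have hd : DifferentiableAt ℝ (g.kahlerForm.inChart e) z :=
      ((g.contDiffOn_kahlerForm he).contDiffAt (e.open_target.mem_nhds hz)).differentiableAt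
        (by simp)
    have h2 := DFunLike.congr_fun h1 ![u, v, w]
    rw [extDeriv_apply_two hd] at h2
    have h3 : ∀ a b c : C2, fderiv ℝ (fun y => g.kahlerForm.inChart e y ![a, b]) z c =
        fderiv ℝ (bilinInChart g.toFun e) z c (mulI a) b := by
      intro a b c
      have h5 : HasFDerivAt (fun y => bilinInChart g.toFun e y (mulI a) b)
          (((fderiv ℝ (bilinInChart g.toFun e) z).flip (mulI a)).flip b) z :=
        (((((g.smooth e he).contDiffAt (e.open_target.mem_nhds hz)).differentiableAt
          (by simp)).hasFDerivAt.clm_apply (hasFDerivAt_const (mulI a) z)).clm_apply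
          (hasFDerivAt_const b z)).congr_fderiv (by ext; simp)
      rw [Filter.EventuallyEq.fderiv_eq (f := fun y => bilinInChart g.toFun e y (mulI a) b),
        h5.fderiv]
      · rfl
      filter_upwards [e.open_target.mem_nhds hz] with y hy
      rw [g.kahlerForm_inChart_apply he hy]
      rfl
    -- The middle term of the exterior derivative carries a minus sign; swapping its arguments gives
    -- the cyclic sum required by `IsKahlerOn`.
    have h6 : (fun y => g.kahlerForm.inChart e y ![u, w]) =
        fun y => -(g.kahlerForm.inChart e y ![w, u]) := by
      funext y
      exact (g.kahlerForm.inChart e y).toAlternatingMap.map_pair_swap _ _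
    have h4 : (RawForm.inChart (0 : RawForm M 3) e z) ![u, v, w] = 0 := rfl
    rw [h4] at h2
    simp only [Matrix.cons_val] at h2
    rw [h6, fderiv_fun_neg, neg_apply, h3, h3, h3] at h2
    linarith

end HermitianPseudoMetric
end Metric
end ComplexSurface
end

/-! ### The Hermitian metric on the canonical bundle defined by the volume density -/

noncomputable section
namespace ComplexSurface

/-- The real coordinates `x₁, y₁, x₂, y₂` on `ℂ²`. -/
def realCoords : C2 ≃ₗ[ℝ] (Fin 4 → ℝ) where
  toFun z := ![(z 0).re, (z 0).im, (z 1).re, (z 1).im]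
  invFun x := ![⟨x 0, x 1⟩, ⟨x 2, x 3⟩]
  map_add' z w := by ext i; fin_cases i <;> simp
  map_smul' c z := by ext i; fin_cases i <;> simp
  left_inv z := by ext i; fin_cases i <;> simp
  right_inv x := by ext i; fin_cases i <;> simp

/-- The vectors `orientedBasis`, as a basis. -/
def realBasis : Module.Basis (Fin 4) ℝ C2 := Module.Basis.ofEquivFun realCoords

theorem realBasis_apply (i : Fin 4) : realBasis i = orientedBasis i := by
  rw [realBasis, Module.Basis.coe_ofEquivFun]
  ext j
  fin_cases i <;> fin_cases j <;>
    simp [realCoords, orientedBasis, Complex.ext_iff]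

theorem coe_realBasis : (realBasis : Fin 4 → C2) = orientedBasis := funext realBasis_apply

/-- The Gram matrices are congruent: the new one is `Aᵀ · gram · A`. -/
theorem det_gram_comp {V : Type*} [NormedAddCommGroup V] [NormedSpace ℝ V] {ι : Type*} [Fintype ι]
    [DecidableEq ι] (b : Module.Basis ι ℝ V) (B B' : V →L[ℝ] V →L[ℝ] ℝ) (A : V →ₗ[ℝ] V)
    (h : ∀ v w, B' v w = B (A v) (A w)) :
    (gram b B').det = LinearMap.det A ^ 2 * (gram b B).det := by
  have h1 : gram b B' = (LinearMap.toMatrix b b A).transpose * gram b B *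
      LinearMap.toMatrix b b A := by
    ext i j
    have e1 : ∀ k, A (b k) = ∑ l, LinearMap.toMatrix b b A l k • b l := fun k => by
      simp only [LinearMap.toMatrix_apply, b.sum_repr]
    simp only [gram, Matrix.of_apply, h, Matrix.mul_apply, Matrix.transpose_apply]
    rw [e1 i, e1 j]
    simp only [map_sum, map_smul, _root_.sum_apply, smul_apply, smul_eq_mul]
    refine Finset.sum_congr rfl fun k _ => ?_
    rw [Finset.mul_sum, Finset.sum_mul]
    exact Finset.sum_congr rfl fun l _ => by ring
  rw [h1, Matrix.det_mul, Matrix.det_mul, Matrix.det_transpose, LinearMap.det_toMatrix]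
  ring

theorem fderiv_fderiv_const_smul {V : Type*} [NormedAddCommGroup V] [NormedSpace ℝ V] (c : ℝ)
    (f : V → ℝ) (z : V) :
    fderiv ℝ (fderiv ℝ fun w => c • f w) z = c • fderiv ℝ (fderiv ℝ f) z := by
  have h : fderiv ℝ (fun w => c • f w) = c • fderiv ℝ f := fderiv_const_smul_field c
  rw [h, fderiv_const_smul_field]
  rfl

section Metric

variable {M : Type*} [TopologicalSpace M] [ChartedSpace C2 M]
variable {e e' : OpenPartialHomeomorph M C2} {z : C2}

/-- The value of an element of the canonical bundle on the standard basis. -/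
def canonicalCoeff {x : M} (α : K x) : ℂ := α (Pi.basisFun ℂ (Fin 2) : Fin 2 → C2)

theorem eq_canonicalCoeff_smul {x : M} (α : K x) :
    α = canonicalCoeff α • (Pi.basisFun ℂ (Fin 2)).det :=
  AlternatingMap.eq_smul_basis_det (Pi.basisFun ℂ (Fin 2)) (M := C2) α

theorem canonicalCoeff_smul {x : M} (c : ℂ) (α : K x) :
    canonicalCoeff (c • α) = c * canonicalCoeff α := rfl

theorem canonicalCoeff_ne_zero {x : M} {α : K x} (h : α ≠ 0) : canonicalCoeff α ≠ 0 := by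
  intro h0
  refine h ?_
  rw [eq_canonicalCoeff_smul α, h0, zero_smul]
  rfl

variable [IsManifold 𝓘(ℂ, C2) ω M]

/-- The coefficient of `dz₁ ∧ dz₂` is the determinant of the derivative of the chart, which is
inverse to `chartDeriv`. -/
theorem canonicalCoeff_frame (he : e ∈ atlas C2 M) (hz : z ∈ e.target) :
    canonicalCoeff (frame e (e.symm z)) * LinearMap.det (chartDeriv e z : C2 →ₗ[ℂ] C2) = 1 := by
  have h := congrArg (fun A : C2 →L[ℂ] C2 => LinearMap.det (A : C2 →ₗ[ℂ] C2))
    (mfderiv_comp_chartDeriv he hz)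
  set A : C2 →L[ℂ] C2 := mfderiv 𝓘(ℂ, C2) 𝓘(ℂ, C2) e (e.symm z) with hA
  have h1 : canonicalCoeff (frame e (e.symm z)) = LinearMap.det (A : C2 →ₗ[ℂ] C2) := by
    have : canonicalCoeff (frame e (e.symm z)) =
      (Pi.basisFun ℂ (Fin 2)).det ((A : C2 →ₗ[ℂ] C2) ∘ (Pi.basisFun ℂ (Fin 2))) := rfl
    rw [this, Module.Basis.det_comp, Module.Basis.det_self, mul_one]
  rw [h1, ← LinearMap.det_comp]
  refine h.trans ?_
  exact LinearMap.det_id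

theorem norm_canonicalCoeff_frame (he : e ∈ atlas C2 M) (hz : z ∈ e.target) :
    ‖canonicalCoeff (frame e (e.symm z))‖ = ‖LinearMap.det (chartDeriv e z : C2 →ₗ[ℂ] C2)‖⁻¹ := by
  have := congrArg norm (canonicalCoeff_frame he hz)
  rw [norm_mul, norm_one] at this
  exact eq_inv_of_mul_eq_one_left this

theorem frame_ne_zero (he : e ∈ atlas C2 M) (hz : z ∈ e.target) : frame e (e.symm z) ≠ 0 := by
  intro h
  have := canonicalCoeff_frame he hz
  rw [h, show canonicalCoeff (0 : K (e.symm z)) = 0 from rfl, zero_mul] at this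
  exact zero_ne_one this

namespace HermitianPseudoMetric

variable (g : HermitianPseudoMetric M)

/-- The metric at `x`, as a bilinear form on `ℂ²`. -/
def form (x : M) : C2 →L[ℝ] C2 →L[ℝ] ℝ := g.toFun x

omit [IsManifold 𝓘(ℂ, C2) ω M] in
theorem det_form_ne_zero (x : M) : (gram realBasis (g.form x)).det ≠ 0 :=
  det_gram_ne_zero _ (g.symm x) (g.nondegenerate x)

/-- The exponent is 4 because the real determinant is the square of the modulus of the complex one,
and it enters a Gram determinant squared. -/
theorem det_bilinInChart (he : e ∈ atlas C2 M) (hz : z ∈ e.target) :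
    (gram realBasis (bilinInChart g.toFun e z)).det =
      ‖LinearMap.det (chartDeriv e z : C2 →ₗ[ℂ] C2)‖ ^ 4 *
        (gram realBasis (g.form (e.symm z))).det := by
  rw [det_gram_comp realBasis (g.form (e.symm z)) _
    ((chartDeriv e z).restrictScalars ℝ : C2 →L[ℝ] C2)
    (fun v w => bilinInChart_apply g.toFun he hz v w), det_restrictScalars_C2]
  ring

/-- The power `-1/2` turns the factor of modulus to the fourth into modulus to the minus two, which
is how the squared norm of `dz₁ ∧ dz₂` must transform. Writing the power through `Real.log` requires
only that the determinants be nonzero. -/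
theorem exp_log_det_bilinInChart (he : e ∈ atlas C2 M) (hz : z ∈ e.target) :
    Real.exp (-(1 / 2) * Real.log (gram realBasis (bilinInChart g.toFun e z)).det) =
      ‖canonicalCoeff (frame e (e.symm z))‖ ^ 2 *
        Real.exp (-(1 / 2) * Real.log (gram realBasis (g.form (e.symm z))).det) := by
  have h0 : 0 < ‖LinearMap.det (chartDeriv e z : C2 →ₗ[ℂ] C2)‖ :=
    norm_pos_iff.mpr (det_chartDeriv_ne_zero he hz)
  rw [g.det_bilinInChart he hz, Real.log_mul (by positivity) (g.det_form_ne_zero _), mul_add,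
    Real.exp_add, norm_canonicalCoeff_frame he hz, Real.log_pow, inv_pow]
  congr 1
  rw [show -(1 / 2) * (((4 : ℕ) : ℝ) * Real.log ‖LinearMap.det (chartDeriv e z : C2 →ₗ[ℂ] C2)‖) =
    -(((2 : ℕ) : ℝ) * Real.log ‖LinearMap.det (chartDeriv e z : C2 →ₗ[ℂ] C2)‖) by push_cast; ring,
    ← Real.log_pow, Real.exp_neg, Real.exp_log (by positivity)]

/-- The Hermitian metric on the canonical bundle defined by the volume density of `g`. -/
def canonicalMetric : CanonicalHermitianMetric M where
  normSq x α := ‖canonicalCoeff α‖ ^ 2 *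
    Real.exp (-(1 / 2) * Real.log (gram realBasis (g.form x)).det)
  normSq_smul x c α := by
    rw [canonicalCoeff_smul, norm_mul]; ring
  normSq_pos x α h := by
    have := norm_pos_iff.mpr (canonicalCoeff_ne_zero h)
    positivity
  smooth e he := by
    have h1 : ContDiffOn ℝ ∞ (fun z => Real.log (gram realBasis (bilinInChart g.toFun e z)).det)
        e.target := by
      refine ContDiffOn.log ?_ fun z hz => det_gram_ne_zero _ (g.bilinInChart_symm he hz)
        (g.bilinInChart_nondegenerate he hz)
      exact Matrix.contDiff_det fun _ _ =>
        ((g.smooth e he).clm_apply contDiffOn_const).clm_apply contDiffOn_const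
    exact (contDiffOn_const.mul h1).exp.congr fun z hz => (g.exp_log_det_bilinInChart he hz).symm

theorem canonicalMetric_frame (he : e ∈ atlas C2 M) (hz : z ∈ e.target) :
    g.canonicalMetric.normSq (e.symm z) (frame e (e.symm z)) =
      Real.exp (-(1 / 2) * Real.log (gram realBasis (bilinInChart g.toFun e z)).det) :=
  (g.exp_log_det_bilinInChart he hz).symm

theorem log_canonicalMetric_frame (he : e ∈ atlas C2 M) (hz : z ∈ e.target) :
    Real.log (g.canonicalMetric.normSq (e.symm z) (frame e (e.symm z))) =
      -(1 / 2) * Real.log (gram realBasis (bilinInChart g.toFun e z)).det := by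
  rw [g.canonicalMetric_frame he hz, Real.log_exp]

end HermitianPseudoMetric

theorem CanonicalHermitianMetric.contDiffOn_log (h : CanonicalHermitianMetric M)
    (he : e ∈ atlas C2 M) :
    ContDiffOn ℝ ∞ (fun z => Real.log (h.normSq (e.symm z) (frame e (e.symm z)))) e.target :=
  (h.smooth e he).log fun _ hz => (h.normSq_pos _ _ (frame_ne_zero he hz)).ne'

namespace HermitianPseudoMetric

variable (g : HermitianPseudoMetric M)

/-- The Kähler form of a Kähler-Einstein metric is, up to a factor, the curvature form of the
canonical bundle. -/
theorem iddbar_log_canonicalMetric (hK : g.IsKahler) {lam : ℝ} (hE : g.IsEinstein lam)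
    (he : e ∈ atlas C2 M) (hz : z ∈ e.target) :
    iddbar (fun w => Real.log (g.canonicalMetric.normSq (e.symm w) (frame e (e.symm w)))) z =
      lam • g.kahlerForm.inChart e z := by
  have hloc := g.isKahlerOn hK he
  have hev : (fun w => Real.log (g.canonicalMetric.normSq (e.symm w) (frame e (e.symm w)))) =ᶠ[𝓝 z]
      fun w => (-(1 / 2) : ℝ) • Real.log (gram realBasis (bilinInChart g.toFun e w)).det := by
    filter_upwards [e.open_target.mem_nhds hz] with w hw using g.log_canonicalMetric_frame he hw
  have h2 : (2 : WithTop ℕ∞) ≤ ∞ := WithTop.coe_le_coe.mpr le_top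
  have hsm := ((g.canonicalMetric.contDiffOn_log he).contDiffAt
    (e.open_target.mem_nhds hz)).of_le h2
  have hdet := ((hloc.contDiffOn_log_det realBasis).contDiffAt (e.open_target.mem_nhds hz)).of_le h2
  have hff : fderiv ℝ (fderiv ℝ fun w => Real.log (g.canonicalMetric.normSq (e.symm w)
      (frame e (e.symm w)))) z = (-(1 / 2) : ℝ) • fderiv ℝ (fderiv ℝ fun w =>
        Real.log (gram realBasis (bilinInChart g.toFun e w)).det) z := by
    rw [hev.fderiv.fderiv_eq]
    exact fderiv_fderiv_const_smul _ _ _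
  ext v
  rw [iddbar_apply hsm, hff]
  have := hloc.einstein_const_mul hz realBasis (hE e he z hz) (v 0) (v 1)
  rw [ContinuousAlternatingMap.smul_apply, g.kahlerForm_inChart_apply he hz, smul_eq_mul, this]
  simp only [smul_apply, smul_eq_mul]
  ring

end HermitianPseudoMetric
end Metric
end ComplexSurface
end

noncomputable section
namespace ComplexSurface

/-! ### Hermitian forms on `ℂ²` -/

/-- A nondegenerate Hermitian form on `ℂ²`, given by its real part. -/
structure IsHermitianForm (B : C2 →L[ℝ] C2 →L[ℝ] ℝ) : Prop where
  symm : ∀ v w, B v w = B w v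
  nondegenerate : ∀ v, (∀ w, B v w = 0) → v = 0
  hermitian : ∀ v w, B (mulI v) (mulI w) = B v w

/-- The determinant of the matrix of a Hermitian form. -/
def hermDet (B : C2 →L[ℝ] C2 →L[ℝ] ℝ) : ℝ :=
  B ![1, 0] ![1, 0] * B ![0, 1] ![0, 1] - B ![1, 0] ![0, 1] ^ 2 - B ![1, 0] ![0, Complex.I] ^ 2

theorem mulI_fst : mulI ![1, 0] = ![Complex.I, 0] := by
  ext i; fin_cases i <;> simp [mulI_apply]

theorem mulI_snd : mulI ![0, 1] = ![0, Complex.I] := by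
  ext i; fin_cases i <;> simp [mulI_apply]

theorem eq_sum_orientedBasis (v : C2) : v = (v 0).re • ![1, 0] + (v 0).im • ![Complex.I, 0] +
    (v 1).re • ![0, 1] + (v 1).im • ![0, Complex.I] := by
  ext i
  fin_cases i <;> simp

namespace IsHermitianForm

variable {B : C2 →L[ℝ] C2 →L[ℝ] ℝ}

theorem smul (h : IsHermitianForm B) {c : ℝ} (hc : c ≠ 0) : IsHermitianForm (c • B) where
  symm v w := by simp [h.symm v w]
  nondegenerate v hv := h.nondegenerate v fun w => by
    have := hv w
    simpa [hc] using this
  hermitian v w := by simp [h.hermitian v w]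

theorem apply_mulI_left (h : IsHermitianForm B) (v w : C2) : B (mulI v) w = -B v (mulI w) := by
  have := h.hermitian v (mulI w)
  rw [mulI_mulI, map_neg] at this
  linarith

theorem apply_mulI_self (h : IsHermitianForm B) (v : C2) : B v (mulI v) = 0 := by
  have h1 := h.apply_mulI_left v v
  rw [h.symm] at h1
  linarith

theorem apply_basis (h : IsHermitianForm B) :
    B ![Complex.I, 0] ![Complex.I, 0] = B ![1, 0] ![1, 0] ∧
    B ![0, Complex.I] ![0, Complex.I] = B ![0, 1] ![0, 1] ∧
    B ![1, 0] ![Complex.I, 0] = 0 ∧ B ![0, 1] ![0, Complex.I] = 0 ∧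
    B ![Complex.I, 0] ![0, Complex.I] = B ![1, 0] ![0, 1] ∧
    B ![Complex.I, 0] ![0, 1] = -B ![1, 0] ![0, Complex.I] := by
  refine ⟨?_, ?_, ?_, ?_, ?_, ?_⟩
  · rw [← mulI_fst, h.hermitian]
  · rw [← mulI_snd, h.hermitian]
  · rw [← mulI_fst, h.apply_mulI_self]
  · rw [← mulI_snd, h.apply_mulI_self]
  · rw [← mulI_fst, ← mulI_snd, h.hermitian]
  · rw [← mulI_fst, ← mulI_snd, h.apply_mulI_left]

theorem apply_eq (h : IsHermitianForm B) (v w : C2) :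
    B v w = B ![1, 0] ![1, 0] * ((v 0).re * (w 0).re + (v 0).im * (w 0).im) +
      B ![0, 1] ![0, 1] * ((v 1).re * (w 1).re + (v 1).im * (w 1).im) +
      B ![1, 0] ![0, 1] * ((v 0).re * (w 1).re + (v 0).im * (w 1).im +
        (w 0).re * (v 1).re + (w 0).im * (v 1).im) +
      B ![1, 0] ![0, Complex.I] * ((v 0).re * (w 1).im - (v 0).im * (w 1).re +
        (w 0).re * (v 1).im - (w 0).im * (v 1).re) := by
  obtain ⟨h1, h2, h3, h4, h5, h6⟩ := h.apply_basis
  conv_lhs => rw [eq_sum_orientedBasis v, eq_sum_orientedBasis w]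
  simp only [map_add, map_smul, add_apply, smul_apply, smul_eq_mul]
  rw [h.symm ![Complex.I, 0] ![1, 0], h.symm ![0, 1] ![1, 0], h.symm ![0, 1] ![Complex.I, 0],
    h.symm ![0, Complex.I] ![1, 0], h.symm ![0, Complex.I] ![Complex.I, 0],
    h.symm ![0, Complex.I] ![0, 1], h1, h2, h3, h4, h5, h6]
  ring

theorem hermDet_ne_zero (h : IsHermitianForm B) : hermDet B ≠ 0 := by
  intro h0
  have hv : ∀ (c q r : ℝ), (![⟨c, 0⟩, ⟨-q, -r⟩] : C2) = 0 → c = 0 ∧ q = 0 ∧ r = 0 := by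
    intro c q r hc
    have h1 := congrFun hc 0
    have h2 := congrFun hc 1
    simp [Complex.ext_iff] at h1 h2
    exact ⟨h1, h2⟩
  unfold hermDet at h0
  -- The witness is a column of the adjugate matrix: its product with `w` is `(w 0).re` times the
  -- determinant. If this column vanishes, the second basis vector itself lies in the kernel.
  obtain ⟨hc, hq, hr⟩ := hv _ _ _ (h.nondegenerate
    ![⟨B ![0, 1] ![0, 1], 0⟩, ⟨-B ![1, 0] ![0, 1], -B ![1, 0] ![0, Complex.I]⟩] fun w => by
      rw [h.apply_eq]
      simp only [Matrix.cons_val_zero, Matrix.cons_val_one]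
      linear_combination (w 0).re * h0)
  have h1 : (![0, 1] : C2) = 0 := h.nondegenerate _ fun w => by
    rw [h.apply_eq, hc, hq, hr]
    simp
  simpa using congrFun h1 1

/-- Sylvester's criterion, by completing the square after multiplication by the first diagonal
entry. -/
theorem posDef_iff (h : IsHermitianForm B) :
    (∀ v, v ≠ 0 → 0 < B v v) ↔ 0 < B ![1, 0] ![1, 0] ∧ 0 < hermDet B := by
  have key : ∀ v : C2, B ![1, 0] ![1, 0] * B v v =
      (B ![1, 0] ![1, 0] * (v 0).re + B ![1, 0] ![0, 1] * (v 1).re +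
        B ![1, 0] ![0, Complex.I] * (v 1).im) ^ 2 +
      (B ![1, 0] ![1, 0] * (v 0).im - B ![1, 0] ![0, Complex.I] * (v 1).re +
        B ![1, 0] ![0, 1] * (v 1).im) ^ 2 + hermDet B * ((v 1).re ^ 2 + (v 1).im ^ 2) := by
    intro v
    rw [h.apply_eq v v, hermDet]
    ring
  constructor
  · intro hp
    have ha : 0 < B ![1, 0] ![1, 0] := hp _ fun h0 => by simpa using congrFun h0 0
    refine ⟨ha, ?_⟩
    -- This vector makes both squares in `key` vanish, leaving the determinant times the square of
    -- the first diagonal entry.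
    have h1 := hp ![⟨-B ![1, 0] ![0, 1], B ![1, 0] ![0, Complex.I]⟩, ⟨B ![1, 0] ![1, 0], 0⟩]
      fun h0 => by
        have := congrFun h0 1
        simp [Complex.ext_iff] at this
        exact ha.ne' this
    have h2 := mul_pos ha h1
    rw [key] at h2
    simp only [Matrix.cons_val_zero, Matrix.cons_val_one] at h2
    ring_nf at h2
    by_contra hd
    nlinarith [sq_nonneg (B ![1, 0] ![1, 0])]
  · rintro ⟨ha, hd⟩ v hv
    have h2 : 0 < B ![1, 0] ![1, 0] * B v v := by
      rw [key]
      by_cases h1 : v 1 = 0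
      · have h0 : v 0 ≠ 0 := fun h0 => hv (by ext i; fin_cases i <;> simp [h0, h1])
        have h3 : 0 < (v 0).re ^ 2 + (v 0).im ^ 2 := by
          have := Complex.normSq_pos.mpr h0
          rw [Complex.normSq_apply] at this
          nlinarith
        rw [h1]
        simp only [Complex.zero_re, Complex.zero_im]
        nlinarith [mul_pos (mul_pos ha ha) h3]
      · have h3 : 0 < (v 1).re ^ 2 + (v 1).im ^ 2 := by
          have := Complex.normSq_pos.mpr h1
          rw [Complex.normSq_apply] at this
          nlinarith
        have := mul_pos hd h3
        positivity
    exact (mul_pos_iff_of_pos_left ha).mp h2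

/-- Nondegeneracy excludes the boundary cases: the determinant is nonzero, and it is at most zero
when the first diagonal entry vanishes. Thus the failure of positivity is an open condition as well.
-/
theorem not_posDef_iff (h : IsHermitianForm B) :
    (¬ ∀ v, v ≠ 0 → 0 < B v v) ↔ B ![1, 0] ![1, 0] < 0 ∨ hermDet B < 0 := by
  rw [h.posDef_iff]
  have h1 := h.hermDet_ne_zero
  constructor
  · intro h2
    rcases lt_or_gt_of_ne h1 with h3 | h3
    · exact Or.inr h3
    · left
      by_contra h4
      rcases (not_lt.mp h4).lt_or_eq with h5 | h5
      · exact h2 ⟨h5, h3⟩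
      · rw [hermDet, ← h5] at h3
        nlinarith [sq_nonneg (B ![1, 0] ![0, 1]), sq_nonneg (B ![1, 0] ![0, Complex.I])]
  · rintro (h2 | h2) ⟨h3, h4⟩ <;> linarith

/-- The determinant of a 2 × 2 matrix does not change under `B ↦ -B`. With a nonnegative
determinant, the criterion for `B` and for `-B` would force the first diagonal entry to be both
negative and positive. -/
theorem hermDet_neg_of_indefinite (h : IsHermitianForm B) (hp : ¬ ∀ v, v ≠ 0 → 0 < B v v)
    (hn : ¬ ∀ v, v ≠ 0 → B v v < 0) : hermDet B < 0 := by
  rcases h.not_posDef_iff.mp hp with h1 | h1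
  · have h2 := (h.smul (c := -1) (by norm_num)).not_posDef_iff.mp (by simpa using hn)
    rcases h2 with h2 | h2
    · simp at h2; linarith
    · simp only [hermDet, smul_apply, smul_eq_mul] at h2
      rw [hermDet]; linarith
  · exact h1

/-- If `B` took no positive value, nondegeneracy would make `-B` positive definite, with positive
determinant. -/
theorem exists_pos (h : IsHermitianForm B) (hd : hermDet B < 0) : ∃ v, 0 < B v v := by
  by_contra hn
  push Not at hn
  have hn' : ∀ v, v ≠ 0 → 0 < ((-1 : ℝ) • B) v v := by
    intro v hv
    have h1 : B v v ≠ 0 := by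
      intro h0
      refine hv (h.nondegenerate v fun w => ?_)
      -- Cauchy–Schwarz for a semidefinite form: the discriminant of `t ↦ B (v + t w) (v + t w)`
      -- shows that a null vector is orthogonal to everything.
      have h2 : ∀ t : ℝ, B w w * (t * t) + 2 * B v w * t + 0 ≤ 0 := by
        intro t
        have := hn (v + t • w)
        simp only [map_add, map_smul, add_apply, smul_apply, smul_eq_mul, h0, h.symm w v] at this
        linarith
      have h3 := discrim_le_zero_of_nonpos h2
      rw [discrim] at h3
      nlinarith [sq_nonneg (B v w)]
    have h2 := (hn v).lt_of_ne h1
    simpa using h2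
  have := ((h.smul (c := -1) (by norm_num)).posDef_iff.mp hn').2
  simp only [hermDet, smul_apply, smul_eq_mul] at this
  rw [hermDet] at hd
  linarith

end IsHermitianForm

/-! ### The signature of an indefinite metric on a connected surface -/

section Signature

variable {M : Type*} [TopologicalSpace M] [ChartedSpace C2 M] [IsManifold 𝓘(ℂ, C2) ω M]
variable {e : OpenPartialHomeomorph M C2} {z : C2}

namespace HermitianPseudoMetric

variable (g : HermitianPseudoMetric M)

theorem isHermitianForm_bilinInChart (he : e ∈ atlas C2 M) (hz : z ∈ e.target) :
    IsHermitianForm (bilinInChart g.toFun e z) :=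
  ⟨g.bilinInChart_symm he hz, g.bilinInChart_nondegenerate he hz, g.bilinInChart_mulI he hz⟩

omit [IsManifold 𝓘(ℂ, C2) ω M] in
theorem continuousOn_bilinInChart_apply (he : e ∈ atlas C2 M) (v w : C2) :
    ContinuousOn (fun z => bilinInChart g.toFun e z v w) e.target :=
  ((g.smooth e he).continuousOn.clm_apply continuousOn_const).clm_apply continuousOn_const

theorem posDef_form_iff (he : e ∈ atlas C2 M) (hz : z ∈ e.target) (c : ℝ) :
    (∀ v, v ≠ 0 → 0 < (c • g.form (e.symm z)) v v) ↔
      ∀ v, v ≠ 0 → 0 < (c • bilinInChart g.toFun e z) v v := by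
  simp only [smul_apply]
  constructor
  · intro h v hv
    rw [bilinInChart_apply _ he hz]
    exact h _ fun h0 => hv (chartDeriv_injective he hz (by rw [h0, map_zero]))
  · intro h v hv
    obtain ⟨w, rfl⟩ := chartDeriv_surjective he hz v
    have := h w fun h0 => hv (by rw [h0, map_zero])
    rw [bilinInChart_apply _ he hz] at this
    exact this

/-- In a chart, `posDef_iff` and `not_posDef_iff` describe the set and its complement by strict
inequalities between continuous functions. The factor `c` covers positive and negative definiteness
at once. -/
theorem isClopen_setOf_posDef {c : ℝ} (hc : c ≠ 0) :
    IsClopen {x : M | ∀ v, v ≠ 0 → 0 < (c • g.form x) v v} := by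
  have hcont : ∀ e ∈ atlas C2 M, ∀ z ∈ e.target, ∀ v w,
      ContinuousAt (fun y => (c • bilinInChart g.toFun e y) v w) z := fun e he z hz v w =>
    ((g.continuousOn_bilinInChart_apply he v w).continuousAt
      (e.open_target.mem_nhds hz)).const_smul c
  have hdet : ∀ e ∈ atlas C2 M, ∀ z ∈ e.target,
      ContinuousAt (fun y => hermDet (c • bilinInChart g.toFun e y)) z := fun e he z hz =>
    (((hcont e he z hz _ _).mul (hcont e he z hz _ _)).sub ((hcont e he z hz _ _).pow 2)).sub
      ((hcont e he z hz _ _).pow 2)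
  have hev : ∀ x : M, ∀ p : C2 → Prop, (∀ᶠ z in 𝓝 (chartAt C2 x x), p z) →
      ∀ᶠ y in 𝓝 x, y ∈ (chartAt C2 x).source ∧ p (chartAt C2 x y) := fun x p hp =>
    ((chartAt C2 x).open_source.mem_nhds (mem_chart_source C2 x) |> Filter.eventually_of_mem <|
      fun _ h => h).and (((chartAt C2 x).continuousAt (mem_chart_source C2 x)).eventually hp)
  have hiff : ∀ x : M, ∀ y ∈ (chartAt C2 x).source, (∀ v, v ≠ 0 → 0 < (c • g.form y) v v) ↔
      ∀ v, v ≠ 0 → 0 < (c • bilinInChart g.toFun (chartAt C2 x) (chartAt C2 x y)) v v := by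
    intro x y hy
    have := g.posDef_form_iff (chart_mem_atlas C2 x) ((chartAt C2 x).map_source hy) c
    rwa [(chartAt C2 x).left_inv hy] at this
  constructor
  · rw [← isOpen_compl_iff, isOpen_iff_eventually]
    intro x hx
    have hx' := (hiff x x (mem_chart_source C2 x)).not.mp hx
    rw [((g.isHermitianForm_bilinInChart (chart_mem_atlas C2 x)
      (mem_chart_target C2 x)).smul hc).not_posDef_iff] at hx'
    have h1 : ∀ᶠ z in 𝓝 (chartAt C2 x x), (c • bilinInChart g.toFun (chartAt C2 x) z) ![1, 0] ![1, 0]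
        < 0 ∨ hermDet (c • bilinInChart g.toFun (chartAt C2 x) z) < 0 := by
      rcases hx' with hx' | hx'
      · exact ((hcont _ (chart_mem_atlas C2 x) _ (mem_chart_target C2 x) _ _).eventually_lt_const
          hx').mono fun _ h => Or.inl h
      · exact ((hdet _ (chart_mem_atlas C2 x) _ (mem_chart_target C2 x)).eventually_lt_const
          hx').mono fun _ h => Or.inr h
    filter_upwards [hev x _ h1] with y hy
    refine (hiff x y hy.1).not.mpr ?_
    rw [((g.isHermitianForm_bilinInChart (chart_mem_atlas C2 x)
      ((chartAt C2 x).map_source hy.1)).smul hc).not_posDef_iff]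
    exact hy.2
  · rw [isOpen_iff_eventually]
    intro x hx
    have hx' := (hiff x x (mem_chart_source C2 x)).mp hx
    rw [((g.isHermitianForm_bilinInChart (chart_mem_atlas C2 x)
      (mem_chart_target C2 x)).smul hc).posDef_iff] at hx'
    have h1 := ((hcont _ (chart_mem_atlas C2 x) _ (mem_chart_target C2 x) _ _).eventually_const_lt
      hx'.1).and ((hdet _ (chart_mem_atlas C2 x) _ (mem_chart_target C2 x)).eventually_const_lt
      hx'.2)
    filter_upwards [hev x _ h1] with y hy
    refine (hiff x y hy.1).mpr ?_
    rw [((g.isHermitianForm_bilinInChart (chart_mem_atlas C2 x)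
      ((chartAt C2 x).map_source hy.1)).smul hc).posDef_iff]
    exact hy.2

/-- `IsIndefinite` only denies definiteness on all of `M`; connectedness turns this into a statement
at each point. -/
theorem not_posDef_form [ConnectedSpace M] (hI : g.IsIndefinite) (y : M) {c : ℝ} (hc : c ≠ 0) :
    ¬ ∀ v, v ≠ 0 → 0 < (c • g.form y) v v := by
  intro hy
  have hall : ∀ (x : M) (v : C2), v ≠ 0 → 0 < c * g.form x v v := by
    rcases isClopen_iff.mp (g.isClopen_setOf_posDef hc) with h | h
    · exact (h ▸ hy : y ∈ (∅ : Set M)).elim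
    · exact fun x => (h ▸ Set.mem_univ x :
        x ∈ {x : M | ∀ v, v ≠ 0 → 0 < (c • g.form x) v v})
  rcases lt_or_gt_of_ne hc with h | h
  · exact hI.2 fun x v hv => neg_of_mul_pos_right (hall x v hv) h.le
  · exact hI.1 fun x v hv => pos_of_mul_pos_right (hall x v hv) h.le

/-- An indefinite Hermitian metric on a connected surface has signature `(2, 2)`. -/
theorem hermDet_bilinInChart_neg [ConnectedSpace M] (hI : g.IsIndefinite) (he : e ∈ atlas C2 M)
    (hz : z ∈ e.target) : hermDet (bilinInChart g.toFun e z) < 0 := by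
  have h1 : ∀ c : ℝ, c ≠ 0 → ¬ ∀ v, v ≠ 0 → 0 < (c • bilinInChart g.toFun e z) v v :=
    fun c hc => (g.posDef_form_iff he hz c).not.mp (g.not_posDef_form hI _ hc)
  refine (g.isHermitianForm_bilinInChart he hz).hermDet_neg_of_indefinite ?_ ?_
  · simpa only [one_smul] using h1 1 one_ne_zero
  · simpa using h1 (-1) (by norm_num)

theorem exists_pos_mul_bilinInChart [ConnectedSpace M] (hI : g.IsIndefinite) (he : e ∈ atlas C2 M)
    (hz : z ∈ e.target) {c : ℝ} (hc : c ≠ 0) : ∃ v, 0 < c * bilinInChart g.toFun e z v v := by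
  obtain ⟨v, hv⟩ := ((g.isHermitianForm_bilinInChart he hz).smul hc).exists_pos (by
    have h1 := mul_pos_of_neg_of_neg (g.hermDet_bilinInChart_neg hI he hz)
      (neg_neg_of_pos (sq_pos_of_ne_zero hc))
    simp only [hermDet, smul_apply, smul_eq_mul] at h1 ⊢
    linarith)
  exact ⟨v, hv⟩

end HermitianPseudoMetric
end Signature
end ComplexSurface
end

noncomputable section
namespace ComplexSurface

/-! ### The maximum principle -/

theorem fderiv_fderiv_comp_affine {V W : Type*} [NormedAddCommGroup V] [NormedSpace ℝ V]
    [NormedAddCommGroup W] [NormedSpace ℝ W] {F : V → ℝ} {z : V} (hF : ContDiffAt ℝ 2 F z)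
    (A : W →L[ℝ] V) (h h' : W) :
    fderiv ℝ (fderiv ℝ fun t => F (z + A t)) 0 h h' =
      fderiv ℝ (fderiv ℝ F) z (A h) (A h') := by
  have hA : ∀ t, HasFDerivAt (fun t => z + A t) A t := fun t => A.hasFDerivAt.const_add z
  have hA0 : z + A 0 = z := by simp
  have h1 : ∀ᶠ t in 𝓝 (0 : W), fderiv ℝ (fun t => F (z + A t)) t = fderiv ℝ F (z + A t) ∘L A := by
    have h2 : ∀ᶠ y in 𝓝 z, ContDiffAt ℝ 2 F y := hF.eventually (by simp)
    have h3 : ContinuousAt (fun t => z + A t) 0 := (hA 0).continuousAt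
    rw [ContinuousAt, hA0] at h3
    filter_upwards [h3.eventually h2] with t ht
    exact ((ht.differentiableAt (by simp)).hasFDerivAt.comp t (hA t)).fderiv
  rw [Filter.EventuallyEq.fderiv_eq h1]
  have h4 : HasFDerivAt (fderiv ℝ F) (fderiv ℝ (fderiv ℝ F) z) (z + A 0) := by
    rw [hA0]
    exact ((hF.fderiv_right (m := 1) (by norm_num [one_add_one_eq_two])).differentiableAt
      (by simp)).hasFDerivAt
  have h5 := (h4.comp 0 (hA 0)).clm_comp (hasFDerivAt_const A (0 : W))
  have h6 := HasFDerivAt.fderiv h5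
  simp only [Function.comp_def] at h6
  rw [h6]
  simp

/-- On the line in the direction `v`, a positive second derivative would make the maximum also a
local minimum. The restriction would then be locally constant, with zero second derivative. -/
theorem fderiv_fderiv_nonpos_of_isLocalMax {V : Type*} [NormedAddCommGroup V] [NormedSpace ℝ V]
    {F : V → ℝ} {z : V} (hF : ContDiffAt ℝ 2 F z) (hmax : IsLocalMax F z) (v : V) :
    fderiv ℝ (fderiv ℝ F) z v v ≤ 0 := by
  by_contra! hpos
  let A : ℝ →L[ℝ] V := (ContinuousLinearMap.id ℝ ℝ).smulRight v
  let p : ℝ → ℝ := fun t => F (z + A t)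
  have hA0 : z + A 0 = z := by simp
  have hp : ContDiffAt ℝ 2 p 0 :=
    ContDiffAt.comp (0 : ℝ) (by rw [hA0]; exact hF) (contDiffAt_const.add A.contDiff.contDiffAt)
  have hcont : ContinuousAt (fun t => z + A t) 0 := by fun_prop
  have hpmax : IsLocalMax p 0 := by
    rw [ContinuousAt, hA0] at hcont
    filter_upwards [hcont.eventually hmax] with t ht
    simpa [p, hA0] using ht
  have hdd : deriv (deriv p) 0 = fderiv ℝ (fderiv ℝ F) z v v := by
    have h1 : fderiv ℝ (fderiv ℝ p) 0 1 1 = fderiv ℝ (fderiv ℝ F) z (A 1) (A 1) :=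
      fderiv_fderiv_comp_affine hF A 1 1
    rw [show A 1 = v by simp [A]] at h1
    have h2 : deriv p = fun t => fderiv ℝ p t 1 := by funext t; simp
    have h3 := (hasFDerivAt_fderiv_apply hp 1).hasDerivAt.deriv
    rw [h2, h3]
    exact h1
  have hmin := isLocalMin_of_deriv_deriv_pos (by rw [hdd]; exact hpos) hpmax.deriv_eq_zero
    hp.continuousAt
  have hconst : p =ᶠ[𝓝 0] fun _ => p 0 := by
    filter_upwards [hpmax, hmin] with t h1 h2 using le_antisymm h1 h2
  have h3 : deriv (deriv p) 0 = 0 := by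
    rw [hconst.deriv.deriv_eq]
    simp
  rw [hdd] at h3
  exact hpos.ne' h3

/-- At a local maximum of `F + c log|f|`, with `f` holomorphic, the Laplacian of `F` is not
positive. -/
theorem fderiv_fderiv_add_nonpos {f : C2 → ℂ} {U : Set C2} (hU : IsOpen U)
    (hf : DifferentiableOn ℂ f U) {z : C2} (hz : z ∈ U) (hfz : f z ≠ 0) {F : C2 → ℝ}
    (hF : ContDiffAt ℝ 2 F z) (c : ℝ)
    (hmax : IsLocalMax (fun y => F y + c * Real.log ‖f y‖) z) (v : C2) :
    fderiv ℝ (fderiv ℝ F) z v v + fderiv ℝ (fderiv ℝ F) z (mulI v) (mulI v) ≤ 0 := by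
  let A : ℂ →L[ℂ] C2 := (ContinuousLinearMap.id ℂ ℂ).smulRight v
  let A' : ℂ →L[ℝ] C2 := A.restrictScalars ℝ
  have hA0 : z + A 0 = z := by simp
  have hcont : ContinuousAt (fun t => z + A t) 0 := by fun_prop
  rw [ContinuousAt, hA0] at hcont
  have hk : AnalyticAt ℂ (fun t => f (z + A t)) 0 := by
    rw [Complex.analyticAt_iff_eventually_differentiableAt]
    filter_upwards [hcont.eventually (hU.mem_nhds hz)] with t ht
    exact DifferentiableAt.comp t (hf.differentiableAt (hU.mem_nhds ht)) (by fun_prop)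
  -- On the complex line through `z` in the direction `v`, the logarithm of the modulus of a
  -- nonvanishing holomorphic function is harmonic; it drops out of the sum of the second
  -- derivatives along `1` and `I`.
  have hharm := hk.harmonicAt_log_norm (by rw [hA0]; exact hfz)
  set l : ℂ → ℝ := fun t => Real.log ‖f (z + A t)‖ with hl
  have hl2 : ContDiffAt ℝ 2 l 0 := hharm.1
  have hlap : fderiv ℝ (fderiv ℝ l) 0 1 1 + fderiv ℝ (fderiv ℝ l) 0 Complex.I Complex.I = 0 := by
    have h1 := hharm.2.eq_of_nhds
    rw [InnerProductSpace.laplacian_eq_iteratedFDeriv_complexPlane] at h1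
    simpa [iteratedFDeriv_two_apply] using h1
  set q : ℂ → ℝ := fun t => F (z + A' t) with hq
  have hq2 : ContDiffAt ℝ 2 q 0 :=
    ContDiffAt.comp (0 : ℂ) (by rw [show z + A' 0 = z from hA0]; exact hF)
      (contDiffAt_const.add A'.contDiff.contDiffAt)
  have hsum : ∀ h : ℂ, fderiv ℝ (fderiv ℝ fun t => q t + c • l t) 0 h h =
      fderiv ℝ (fderiv ℝ q) 0 h h + c * fderiv ℝ (fderiv ℝ l) 0 h h := by
    intro h
    have h2 : ContDiffAt ℝ 2 (fun t => c • l t) 0 := hl2.const_smul c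
    have h1 : fderiv ℝ (fun t => q t + c • l t) =ᶠ[𝓝 0]
        fun t => fderiv ℝ q t + fderiv ℝ (fun t => c • l t) t := by
      filter_upwards [hq2.eventually (by simp), h2.eventually (by simp)] with t h3 h4
      exact fderiv_fun_add (h3.differentiableAt (by simp)) (h4.differentiableAt (by simp))
    rw [h1.fderiv_eq, fderiv_fun_add
      ((hq2.fderiv_right (m := 1) (by norm_num [one_add_one_eq_two])).differentiableAt (by simp))
      ((h2.fderiv_right (m := 1) (by norm_num [one_add_one_eq_two])).differentiableAt (by simp)),
      fderiv_fderiv_const_smul]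
    rfl
  have hmax' : IsLocalMax (fun t => q t + c • l t) 0 := by
    filter_upwards [hcont.eventually hmax] with t ht
    have h3 : q t + c • l t ≤ F z + c * Real.log ‖f z‖ := ht
    have h4 : q 0 + c • l 0 = F z + c * Real.log ‖f z‖ := by
      simp [q, l]
    rwa [h4]
  have h1 := fderiv_fderiv_nonpos_of_isLocalMax (hq2.add (hl2.const_smul c)) hmax' 1
  have h2 := fderiv_fderiv_nonpos_of_isLocalMax (hq2.add (hl2.const_smul c)) hmax' Complex.I
  rw [hsum] at h1 h2
  rw [hq, fderiv_fderiv_comp_affine hF] at h1 h2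
  have e1 : A' 1 = v := by simp [A', A]
  have e2 : A' Complex.I = mulI v := by simp [A', A, mulI_apply]
  rw [e1] at h1
  rw [e2] at h2
  linear_combination h1 + h2 - c * hlap

/-! ### Vanishing of the pluricanonical sections -/

section Sections

variable {M : Type*} [TopologicalSpace M] [ChartedSpace C2 M]

/-- The value on the standard basis of an element of a power of the canonical bundle. -/
def tensorCoeff {x : M} {m : ℕ} : (⨂[ℂ] _ : Fin m, K x) →ₗ[ℂ] ℂ :=
  PiTensorProduct.lift ((MultilinearMap.mkPiAlgebra ℂ (Fin m) ℂ).compLinearMap fun _ =>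
    { toFun := canonicalCoeff
      map_add' := fun _ _ => rfl
      map_smul' := fun _ _ => rfl })

theorem tensorCoeff_tprod {x : M} {m : ℕ} (α : K x) :
    tensorCoeff (PiTensorProduct.tprod ℂ fun _ : Fin m => α) = canonicalCoeff α ^ m := by
  simp [tensorCoeff]
  rfl

variable [IsManifold 𝓘(ℂ, C2) ω M]

namespace HermitianPseudoMetric

variable (g : HermitianPseudoMetric M)

/-- The squared norm on a power of the canonical bundle. -/
def pluriNormSq {m : ℕ} {x : M} (s : ⨂[ℂ] _ : Fin m, K x) : ℝ :=
  ‖tensorCoeff s‖ ^ 2 * Real.exp (-(1 / 2) * Real.log (gram realBasis (g.form x)).det) ^ m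

theorem pluriNormSq_eq {e : OpenPartialHomeomorph M C2} {z : C2} {m : ℕ} (c : ℂ) :
    g.pluriNormSq (c • PiTensorProduct.tprod ℂ (fun _ : Fin m => frame e (e.symm z))) =
      ‖c‖ ^ 2 * g.canonicalMetric.normSq (e.symm z) (frame e (e.symm z)) ^ m := by
  rw [pluriNormSq, map_smul, tensorCoeff_tprod, smul_eq_mul, norm_mul, norm_pow]
  simp only [canonicalMetric]
  rw [mul_pow, mul_pow (_ ^ 2)]
  ring

theorem continuous_pluriNormSq {m : ℕ} {s : ∀ x : M, ⨂[ℂ] _ : Fin m, K x}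
    (hs : s ∈ pluricanonicalSections M m) : Continuous fun x => g.pluriNormSq (s x) := by
  rw [continuous_iff_continuousAt]
  intro x
  obtain ⟨f, hf, hsf⟩ := hs _ (chart_mem_atlas C2 x)
  set e := chartAt C2 x with he
  have hx : x ∈ e.source := mem_chart_source C2 x
  have h1 : ContinuousAt (fun z => ‖f z‖ ^ 2 * g.canonicalMetric.normSq (e.symm z)
      (frame e (e.symm z)) ^ m) (e x) := by
    have h2 := e.open_target.mem_nhds (e.map_source hx)
    exact ((hf.continuousOn.continuousAt h2).norm.pow 2).mul
      ((((g.canonicalMetric.smooth e (chart_mem_atlas C2 x)).continuousOn).continuousAt h2).pow m)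
  refine (ContinuousAt.comp (f := e) h1 (e.continuousAt hx)).congr ?_
  filter_upwards [e.open_source.mem_nhds hx] with y hy
  have h3 := g.pluriNormSq_eq (e := e) (z := e y) (m := m) (f (e y))
  rw [← hsf _ (e.map_source hy)] at h3
  exact h3.symm.trans (by rw [e.left_inv hy])

/-- The powers of the canonical bundle of an indefinite Kähler-Einstein surface have no
holomorphic sections. -/
theorem pluricanonicalSections_eq_bot [CompactSpace M] [ConnectedSpace M] (hK : g.IsKahler)
    (hI : g.IsIndefinite) {lam : ℝ} (hlam : lam ≠ 0) (hE : g.IsEinstein lam) {m : ℕ} (hm : 1 ≤ m) :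
    pluricanonicalSections M m = ⊥ := by
  rw [eq_bot_iff]
  intro s hs
  -- A maximum of the norm exists by compactness: the cocompact filter is trivial, so the condition
  -- at infinity is empty.
  obtain ⟨x₀, hx₀⟩ := (g.continuous_pluriNormSq hs).exists_forall_ge' (x₀ := Classical.arbitrary M)
    (by simp [Filter.cocompact_eq_bot])
  have hnorm : ∀ e ∈ atlas C2 M, ∀ f : C2 → ℂ, (∀ z ∈ e.target, s (e.symm z) =
      f z • PiTensorProduct.tprod ℂ (fun _ => frame e (e.symm z))) → ∀ z ∈ e.target,
      g.pluriNormSq (s (e.symm z)) =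
        ‖f z‖ ^ 2 * g.canonicalMetric.normSq (e.symm z) (frame e (e.symm z)) ^ m :=
    fun e he f hsf z hz => by rw [hsf z hz, g.pluriNormSq_eq]
  have hpos : ∀ e ∈ atlas C2 M, ∀ z ∈ e.target,
      0 < g.canonicalMetric.normSq (e.symm z) (frame e (e.symm z)) := fun e he z hz =>
    g.canonicalMetric.normSq_pos _ _ (frame_ne_zero he hz)
  suffices h0 : g.pluriNormSq (s x₀) = 0 by
    rw [Submodule.mem_bot]
    funext x
    have he := chart_mem_atlas C2 x
    obtain ⟨f, hf, hsf⟩ := hs _ he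
    have hz := mem_chart_target C2 x
    have h1 := hnorm _ he f hsf _ hz
    have h2 := hsf _ hz
    have h3 := hx₀ x
    rw [(chartAt C2 x).left_inv (mem_chart_source C2 x)] at h1 h2
    rw [h0, h1] at h3
    have h4 := pow_pos (hpos _ he _ hz) m
    rw [(chartAt C2 x).left_inv (mem_chart_source C2 x)] at h4
    have h5 : ‖f (chartAt C2 x x)‖ ^ 2 ≤ 0 := by
      by_contra! h6
      exact (mul_pos h6 h4).not_ge h3
    have h6 : f (chartAt C2 x x) = 0 := by
      have := pow_eq_zero_iff (two_ne_zero) |>.mp (le_antisymm h5 (by positivity))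
      exact norm_eq_zero.mp this
    rw [h2, h6, zero_smul]
    rfl
  by_contra hne
  have he := chart_mem_atlas C2 x₀
  obtain ⟨f, hf, hsf⟩ := hs _ he
  set e := chartAt C2 x₀
  set z := e x₀
  have hz : z ∈ e.target := mem_chart_target C2 x₀
  have hez : e.symm z = x₀ := e.left_inv (mem_chart_source C2 x₀)
  have hfz : f z ≠ 0 := by
    intro h
    have := hnorm e he f hsf z hz
    rw [h, hez] at this
    simp at this
    exact hne this
  set F : C2 → ℝ := fun y => Real.log (g.canonicalMetric.normSq (e.symm y) (frame e (e.symm y)))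
  have hF : ContDiffAt ℝ 2 F z := ((g.canonicalMetric.contDiffOn_log he).contDiffAt
    (e.open_target.mem_nhds hz)).of_le (WithTop.coe_le_coe.mpr le_top)
  -- Since `‖s‖² = ‖f‖² exp(F)^m`, the function `(1/m) log ‖s‖²` equals `F + (2/m) log ‖f‖`; this is
  -- the origin of the factor `2 / m`.
  have hmax : IsLocalMax (fun y => F y + (2 / m : ℝ) * Real.log ‖f y‖) z := by
    have hf0 : ∀ᶠ y in 𝓝 z, f y ≠ 0 :=
      (hf.continuousOn.continuousAt (e.open_target.mem_nhds hz)).eventually_ne hfz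
    have hlog : ∀ y ∈ e.target, f y ≠ 0 → F y + (2 / m : ℝ) * Real.log ‖f y‖ =
        (1 / m : ℝ) * Real.log (g.pluriNormSq (s (e.symm y))) := by
      intro y hy hfy
      have hm0 : (m : ℝ) ≠ 0 := by positivity
      rw [hnorm e he f hsf y hy, Real.log_mul (by positivity) (pow_pos (hpos e he y hy) m).ne',
        Real.log_pow, Real.log_pow]
      simp only [F]
      field_simp
      push_cast
      ring
    filter_upwards [hf0, e.open_target.mem_nhds hz] with y hfy hy
    rw [hlog y hy hfy, hlog z hz hfz, hez]
    refine mul_le_mul_of_nonneg_left (Real.log_le_log ?_ (hx₀ _)) (by positivity)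
    rw [hnorm e he f hsf y hy]
    exact mul_pos (by positivity) (pow_pos (hpos e he y hy) m)
  obtain ⟨v, hv⟩ := g.exists_pos_mul_bilinInChart hI he hz hlam
  -- The left side of the inequality is twice `i∂∂̄ F (v, Iv)`, that is `2λ g(v, v)`, which is
  -- positive by the choice of `v`.
  have h1 := fderiv_fderiv_add_nonpos e.open_target hf hz hfz hF _ hmax v
  have h2 := DFunLike.congr_fun (g.iddbar_log_canonicalMetric hK hE he hz) ![v, mulI v]
  rw [iddbar_apply hF, ContinuousAlternatingMap.smul_apply, g.kahlerForm_inChart_apply he hz] at h2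
  simp only [Matrix.cons_val_zero, Matrix.cons_val_one, mulI_mulI, map_neg, smul_eq_mul,
    g.bilinInChart_mulI he hz] at h2
  linarith

theorem kodairaDimension_eq_bot [CompactSpace M] [ConnectedSpace M] (hK : g.IsKahler)
    (hI : g.IsIndefinite) {lam : ℝ} (hlam : lam ≠ 0) (hE : g.IsEinstein lam) :
    kodairaDimension M = ⊥ := by
  rw [kodairaDimension, if_pos]
  intro m hm
  rw [plurigenus, g.pluricanonicalSections_eq_bot hK hI hlam hE hm]
  simp

end HermitianPseudoMetric
end Sections
end ComplexSurface
end

noncomputable section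
namespace ComplexSurface

/-! ### Top degree forms -/

open Equiv.Perm in
theorem sum_perm_fin_succ {n : ℕ} (F : Equiv.Perm (Fin (n + 1)) → ℝ) :
    ∑ σ, F σ = ∑ p, ∑ τ, F (decomposeFin.symm (p, τ)) := by
  rw [← Equiv.sum_comp decomposeFin.symm, Fintype.sum_prod_type]

/-- Permutations are enumerated by removing one point at a time with `decomposeFin`; every nonzero
choice contributes a transposition and hence a sign. -/
theorem sum_perm_fin_four (F : Equiv.Perm (Fin 4) → ℝ) (f : Fin 4 → Fin 4 → Fin 4 → Fin 4 → ℝ)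
    (hF : ∀ σ, F σ = ((Equiv.Perm.sign σ : ℤˣ) : ℤ) * f (σ 0) (σ 1) (σ 2) (σ 3)) :
    ∑ σ, F σ =
      f 0 1 2 3 - f 0 1 3 2 - f 0 2 1 3 + f 0 2 3 1 + f 0 3 1 2 - f 0 3 2 1
      - f 1 0 2 3 + f 1 0 3 2 + f 1 2 0 3 - f 1 2 3 0 - f 1 3 0 2 + f 1 3 2 0
      + f 2 0 1 3 - f 2 0 3 1 - f 2 1 0 3 + f 2 1 3 0 + f 2 3 0 1 - f 2 3 1 0
      - f 3 0 1 2 + f 3 0 2 1 + f 3 1 0 2 - f 3 1 2 0 - f 3 2 0 1 + f 3 2 1 0 := by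
  have key : ∀ p q r, F (Equiv.Perm.decomposeFin.symm (p, Equiv.Perm.decomposeFin.symm (q,
      Equiv.Perm.decomposeFin.symm (r, 1)))) =
      ((if p = 0 then 1 else -1) * ((if q = 0 then 1 else -1) * (if r = 0 then 1 else -1))) *
      f p (Equiv.swap 0 p (Fin.succ q)) (Equiv.swap 0 p (Fin.succ (Equiv.swap 0 q (Fin.succ r))))
       (Equiv.swap 0 p (Fin.succ (Equiv.swap 0 q (Fin.succ (Equiv.swap 0 r 1))))) := by
    intro p q r
    rw [hF]
    rw [Equiv.Perm.decomposeFin_symm_apply_zero, show (1 : Fin 4) = Fin.succ 0 from rfl,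
      show (2 : Fin 4) = Fin.succ (Fin.succ 0) from rfl,
      show (3 : Fin 4) = Fin.succ (Fin.succ 1) from rfl]
    simp only [Equiv.Perm.decomposeFin_symm_apply_succ, Equiv.Perm.decomposeFin_symm_apply_zero,
      Equiv.Perm.decomposeFin_symm_apply_one, Equiv.Perm.decomposeFin.symm_sign]
    congr 1
    split_ifs <;> simp
  simp only [sum_perm_fin_succ (n := 3), sum_perm_fin_succ (n := 2), sum_perm_fin_succ (n := 1),
    Fintype.sum_subsingleton _ (1 : Equiv.Perm (Fin 1)), key, Fin.sum_univ_four,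
    Fin.sum_univ_three, Fin.sum_univ_two]
  simp [Equiv.swap_apply_def, Fin.ext_iff]
  ring

/-- The alternatization of `α ⊗ β` is `2! · 2!` times the shuffle product. Its 24 terms reduce to
six shuffles, each occurring four times by antisymmetry of `α` and `β`. -/
theorem domCoprod_fin_two_apply {V : Type*} [AddCommGroup V] [Module ℝ V]
    (α β : V [⋀^Fin 2]→ₗ[ℝ] ℝ) (v : Fin 4 → V) : LinearMap.mul' ℝ ℝ (α.domCoprod β (v ∘ finSumFinEquiv)) =
      α ![v 0, v 1] * β ![v 2, v 3] - α ![v 0, v 2] * β ![v 1, v 3]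
      + α ![v 0, v 3] * β ![v 1, v 2] + α ![v 1, v 2] * β ![v 0, v 3]
      - α ![v 1, v 3] * β ![v 0, v 2] + α ![v 2, v 3] * β ![v 0, v 1] := by
  have h := congrArg (fun A => LinearMap.mul' ℝ ℝ (A (v ∘ finSumFinEquiv)))
    (MultilinearMap.domCoprod_alternization_eq α β)
  simp only [MultilinearMap.alternatization_apply, AlternatingMap.smul_apply, map_nsmul, map_sum] at h
  rw [← Equiv.sum_comp (Equiv.permCongr (finSumFinEquiv (m := 2) (n := 2)).symm)] at h
  rw [sum_perm_fin_four _ (fun i j k l => α ![v i, v j] * β ![v k, v l])] at h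
  · have sα : ∀ i j, α ![v i, v j] = -α ![v j, v i] := fun i j => α.map_pair_swap _ _
    have sβ : ∀ i j, β ![v i, v j] = -β ![v j, v i] := fun i j => β.map_pair_swap _ _
    simp only [Fintype.card_fin, Nat.factorial_two, nsmul_eq_mul] at h
    rw [sα 1 0, sα 2 0, sα 3 0, sα 2 1, sα 3 1, sα 3 2, sβ 1 0, sβ 2 0, sβ 3 0, sβ 2 1, sβ 3 1,
      sβ 3 2] at h
    push_cast at h
    linarith
  · intro σ
    have h1 : (fun i => v (σ (finSumFinEquiv (m := 2) (n := 2) (Sum.inl i)))) = ![v (σ 0), v (σ 1)] := by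
      ext i : 1
      fin_cases i <;> rfl
    have h2 : (fun i => v (σ (finSumFinEquiv (m := 2) (n := 2) (Sum.inr i)))) = ![v (σ 2), v (σ 3)] := by
      ext i : 1
      fin_cases i <;> rfl
    simp [h1, h2]
    rw [Units.smul_def, zsmul_eq_mul]

/-- The wedge product of two forms of degree 2, as a sum over shuffles. -/
theorem wedge_apply {V : Type*} [AddCommGroup V] [Module ℝ V] (α β : V [⋀^Fin 2]→ₗ[ℝ] ℝ)
    (v : Fin 4 → V) : wedge α β v =
      α ![v 0, v 1] * β ![v 2, v 3] - α ![v 0, v 2] * β ![v 1, v 3]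
      + α ![v 0, v 3] * β ![v 1, v 2] + α ![v 1, v 2] * β ![v 0, v 3]
      - α ![v 1, v 3] * β ![v 0, v 2] + α ![v 2, v 3] * β ![v 0, v 1] :=
  domCoprod_fin_two_apply α β v

/-! ### Integration of forms of top degree in charts -/

section Integral

variable {M : Type*} [TopologicalSpace M] [ChartedSpace C2 M]
variable {e e' : OpenPartialHomeomorph M C2} {z : C2}

/-- The (not necessarily smooth) forms of top degree on `M`. -/
abbrev TopForm (M : Type*) [TopologicalSpace M] [ChartedSpace C2 M] :=
  ∀ x : M, T x [⋀^Fin 4]→ₗ[ℝ] ℝ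

/-- The coefficient of a form of top degree in a chart. -/
def TopForm.coeff (μ : TopForm M) (e : OpenPartialHomeomorph M C2) (z : C2) : ℝ :=
  μ (e.symm z) fun i => chartDeriv e z (orientedBasis i)

/-- The integral of a form of top degree over the domain of a chart. -/
def TopForm.chartIntegral (μ : TopForm M) (e : OpenPartialHomeomorph M C2) : ℝ :=
  ∫ z in e.target, μ.coeff e z

/-- The wedge product of two fields of 2-forms. -/
def RawForm.wedge (α β : RawForm M 2) : TopForm M := fun x =>
  ComplexSurface.wedge (α x).toAlternatingMap (β x).toAlternatingMap

variable [IsManifold 𝓘(ℂ, C2) ω M]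

theorem RawForm.coeff_wedge (he : e ∈ atlas C2 M) (hz : z ∈ e.target) (α β : RawForm M 2) :
    (α.wedge β).coeff e z =
      ComplexSurface.wedge (α.inChart e z).toAlternatingMap (β.inChart e z).toAlternatingMap
        orientedBasis := by
  have hp : ∀ u w : C2, (fun i => chartDeriv e z (![u, w] i)) =
      ![chartDeriv e z u, chartDeriv e z w] := fun u w => by
    ext i : 1
    fin_cases i <;> rfl
  have h : ∀ (γ : RawForm M 2) (u w : C2), (γ.inChart e z).toAlternatingMap ![u, w] =
      (γ (e.symm z)).toAlternatingMap ![chartDeriv e z u, chartDeriv e z w] := fun γ u w =>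
    (γ.inChart_apply he hz _).trans (congrArg (γ (e.symm z)) (hp u w))
  rw [wedge_apply]
  simp only [h]
  exact wedge_apply _ _ _

/-- A top form scales by the determinant of the coordinate change. For a holomorphic change this
determinant is nonnegative, so it is its own absolute value and matches the change of variables
formula. -/
theorem TopForm.coeff_trans (μ : TopForm M) (he : e ∈ atlas C2 M) (he' : e' ∈ atlas C2 M)
    (hz : z ∈ e.target) (hz' : e.symm z ∈ e'.source) :
    μ.coeff e z = |((transDeriv e e' z).restrictScalars ℝ : C2 →L[ℝ] C2).det| *
      μ.coeff e' (e' (e.symm z)) := by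
  have hdet := det_restrictScalars_C2 (transDeriv e e' z)
  rw [ContinuousLinearMap.det, hdet, abs_of_nonneg (by positivity), ← hdet]
  set A : C2 →ₗ[ℝ] C2 := (((transDeriv e e' z).restrictScalars ℝ : C2 →L[ℝ] C2) : C2 →ₗ[ℝ] C2)
  let ν : C2 [⋀^Fin 4]→ₗ[ℝ] ℝ := (μ (e.symm z)).compLinearMap
    (((chartDeriv e' (e' (e.symm z))).restrictScalars ℝ : C2 →L[ℝ] C2) : C2 →ₗ[ℝ] C2)
  have h1 : μ.coeff e z = ν (A ∘ realBasis) := by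
    rw [coe_realBasis, TopForm.coeff, chartDeriv_trans he he' hz hz']
    rfl
  have h2 : μ.coeff e' (e' (e.symm z)) = ν realBasis := by
    rw [coe_realBasis, TopForm.coeff, e'.left_inv hz']
    rfl
  rw [h1, h2, ν.eq_smul_basis_det realBasis]
  simp only [AlternatingMap.smul_apply, Module.Basis.det_comp, smul_eq_mul]
  ring

/-- The integral of a form supported in the domains of two charts may be computed in either. -/
theorem TopForm.chartIntegral_eq (μ : TopForm M) (he : e ∈ atlas C2 M) (he' : e' ∈ atlas C2 M)
    (hμ : ∀ x, x ∉ e.source → μ x = 0) (hμ' : ∀ x, x ∉ e'.source → μ x = 0) :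
    μ.chartIntegral e = μ.chartIntegral e' := by
  let φ := e.symm.trans e'
  have hs : φ.source = e.target ∩ e.symm ⁻¹' e'.source := by
    simp [φ]
  have ht : φ.target = e'.target ∩ e'.symm ⁻¹' e.source := by
    simp [φ]
  have h1 : μ.chartIntegral e = ∫ z in φ.source, μ.coeff e z := by
    rw [TopForm.chartIntegral, hs]
    refine MeasureTheory.setIntegral_eq_of_subset_of_forall_sdiff_eq_zero
      e.open_target.measurableSet Set.inter_subset_left ?_
    rintro z ⟨hz, hz'⟩
    rw [TopForm.coeff, hμ' _ fun h => hz' ⟨hz, h⟩]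
    rfl
  have h2 : μ.chartIntegral e' = ∫ z in φ.target, μ.coeff e' z := by
    rw [TopForm.chartIntegral, ht]
    refine MeasureTheory.setIntegral_eq_of_subset_of_forall_sdiff_eq_zero
      e'.open_target.measurableSet Set.inter_subset_left ?_
    rintro z ⟨hz, hz'⟩
    rw [TopForm.coeff, hμ _ fun h => hz' ⟨hz, h⟩]
    rfl
  -- Both integrals have been reduced to the overlap of the charts, where the Jacobian is the factor
  -- in `coeff_trans`.
  rw [h1, h2, MeasureTheory.integral_target_eq_integral_abs_det_fderiv_smul MeasureTheory.volume
    (f := φ) (f' := fun z => (transDeriv e e' z).restrictScalars ℝ)]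
  · refine MeasureTheory.setIntegral_congr_fun φ.open_source.measurableSet fun z hz => ?_
    rw [hs] at hz
    exact μ.coeff_trans he he' hz.1 hz.2
  · intro z hz
    rw [hs] at hz
    exact (hasFDerivAt_trans he he' hz.1 hz.2).restrictScalars ℝ

end Integral
end ComplexSurface
end

noncomputable section
namespace ComplexSurface

/-! ### Stokes' theorem for compactly supported forms in a chart -/

section Stokes

open MeasureTheory

variable {U K : Set C2}

theorem contDiff_indicator (hU : IsOpen U) (hK : IsCompact K) (hKU : K ⊆ U) {X : C2 → ℝ}
    (hX : ContDiffOn ℝ 1 X U) (h0 : ∀ z ∈ U, z ∉ K → X z = 0) : ContDiff ℝ 1 (U.indicator X) := by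
  rw [contDiff_iff_contDiffAt]
  intro z
  by_cases hz : z ∈ K
  · refine ((hX.contDiffAt (hU.mem_nhds (hKU hz)))).congr_of_eventuallyEq ?_
    filter_upwards [hU.mem_nhds (hKU hz)] with y hy using Set.indicator_of_mem hy X
  · refine (contDiffAt_const (c := (0 : ℝ))).congr_of_eventuallyEq ?_
    filter_upwards [hK.isClosed.isOpen_compl.mem_nhds hz] with y hy
    by_cases hyU : y ∈ U
    · rw [Set.indicator_of_mem hyU, h0 y hyU hy]
    · exact Set.indicator_of_notMem hyU X

/-- Extended by zero, `X` is a `C¹` function with compact support on the whole space; integrate by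
parts against the constant 1. -/
theorem setIntegral_fderiv_eq_zero (hU : IsOpen U) (hK : IsCompact K) (hKU : K ⊆ U) {X : C2 → ℝ}
    (hX : ContDiffOn ℝ 1 X U) (h0 : ∀ z ∈ U, z ∉ K → X z = 0) (v : C2) :
    IntegrableOn (fun z => fderiv ℝ X z v) U ∧ ∫ z in U, fderiv ℝ X z v = 0 := by
  set Y := U.indicator X with hY
  have hYc := contDiff_indicator hU hK hKU hX h0
  have hY0 : ∀ z, z ∉ K → Y z = 0 := fun z hz => by
    by_cases hzU : z ∈ U
    · rw [hY, Set.indicator_of_mem hzU, h0 z hzU hz]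
    · exact Set.indicator_of_notMem hzU X
  have hsupp : HasCompactSupport Y := HasCompactSupport.intro hK hY0
  have hfd : ∀ z ∈ U, fderiv ℝ Y z = fderiv ℝ X z := fun z hz => by
    refine Filter.EventuallyEq.fderiv_eq ?_
    filter_upwards [hU.mem_nhds hz] with y hy using Set.indicator_of_mem hy X
  have hfd0 : ∀ z, z ∉ K → fderiv ℝ Y z = 0 := fun z hz => by
    have : Y =ᶠ[𝓝 z] fun _ => 0 := by
      filter_upwards [hK.isClosed.isOpen_compl.mem_nhds hz] with y hy using hY0 y hy
    rw [this.fderiv_eq, fderiv_fun_const]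
    rfl
  have hcont : Continuous fun z => fderiv ℝ Y z v :=
    (hYc.continuous_fderiv (by simp)).clm_apply continuous_const
  have hint : Integrable fun z => fderiv ℝ Y z v :=
    hcont.integrable_of_hasCompactSupport (HasCompactSupport.intro hK fun z hz => by
      rw [hfd0 z hz]; rfl)
  have hzero : ∫ z, fderiv ℝ Y z v = 0 := by
    have := integral_mul_fderiv_eq_neg_fderiv_mul_of_integrable (μ := (volume : Measure C2))
      (f := fun _ => (1 : ℝ)) (g := Y) (v := v) (by simp) (by simpa using hint)
      (by simpa using hYc.continuous.integrable_of_hasCompactSupport hsupp)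
      (fun _ _ => differentiableAt_const _)
      (fun z _ => hYc.differentiable (by simp) z)
    simpa using this
  refine ⟨(hint.integrableOn (s := U)).congr_fun (fun z hz => by
    simp only [hfd z hz]) hU.measurableSet, ?_⟩
  rw [← setIntegral_congr_fun (f := fun z => fderiv ℝ Y z v) hU.measurableSet
    fun z hz => by simp only [hfd z hz], setIntegral_eq_integral_of_forall_compl_eq_zero, hzero]
  intro z hz
  rw [hfd0 z fun h => hz (hKU h)]
  rfl

theorem contDiffOn_apply {k : ℕ} {n : WithTop ℕ∞} {α : C2 → C2 [⋀^Fin k]→L[ℝ] ℝ}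
    (hα : ContDiffOn ℝ n α U) (v : Fin k → C2) : ContDiffOn ℝ n (fun y => α y v) U := by
  have h : ContDiff ℝ n fun A : C2 [⋀^Fin k]→L[ℝ] ℝ => A v :=
    (ContinuousAlternatingMap.apply ℝ C2 ℝ v).contDiff
  exact h.comp_contDiffOn hα

theorem fderiv_mul_sub_add {V : Type*} [NormedAddCommGroup V] [NormedSpace ℝ V]
    {u a p b q c r : V → ℝ} {z : V} (hu : DifferentiableAt ℝ u z)
    (ha : DifferentiableAt ℝ a z) (hp : DifferentiableAt ℝ p z) (hb : DifferentiableAt ℝ b z)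
    (hq : DifferentiableAt ℝ q z) (hc : DifferentiableAt ℝ c z) (hr : DifferentiableAt ℝ r z)
    (v : V) :
    fderiv ℝ (fun y => u y * (a y * p y - b y * q y + c y * r y)) z v =
      fderiv ℝ u z v * (a z * p z - b z * q z + c z * r z) +
      u z * (fderiv ℝ a z v * p z + a z * fderiv ℝ p z v - (fderiv ℝ b z v * q z +
        b z * fderiv ℝ q z v) + (fderiv ℝ c z v * r z + c z * fderiv ℝ r z v)) := by
  have h := hu.hasFDerivAt.mul (((ha.hasFDerivAt.mul hp.hasFDerivAt).sub
    (hb.hasFDerivAt.mul hq.hasFDerivAt)).add (hc.hasFDerivAt.mul hr.hasFDerivAt))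
  have h2 := DFunLike.congr_fun h.fderiv v
  refine Eq.trans ?_ (h2.trans ?_)
  · rfl
  · simp
    ring

/-- The integral of `d(u α) ∧ Z` vanishes if `Z` is closed and `u` has compact support. -/
theorem setIntegral_wedge_exact (hU : IsOpen U) (hK : IsCompact K) (hKU : K ⊆ U) {u : C2 → ℝ}
    (hu : ContDiffOn ℝ ∞ u U) (hu0 : ∀ z ∈ U, z ∉ K → u z = 0)
    {α : C2 → C2 [⋀^Fin 1]→L[ℝ] ℝ} (hα : ContDiffOn ℝ ∞ α U)
    {Z : C2 → C2 [⋀^Fin 2]→L[ℝ] ℝ} (hZ : ContDiffOn ℝ ∞ Z U) (hdZ : ∀ z ∈ U, extDeriv Z z = 0)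
    {β : C2 → C2 [⋀^Fin 2]→ₗ[ℝ] ℝ} (hβ : ∀ z ∈ U, ∀ v w, β z ![v, w] =
      fderiv ℝ u z v * α z (fun _ => w) - fderiv ℝ u z w * α z (fun _ => v) +
      u z * (fderiv ℝ (fun y => α y fun _ => w) z v - fderiv ℝ (fun y => α y fun _ => v) z w)) :
    ∫ z in U, wedge (β z) (Z z).toAlternatingMap orientedBasis = 0 := by
  let a : Fin 4 → C2 → ℝ := fun i y => α y fun _ => orientedBasis i
  let ζ : Fin 4 → Fin 4 → C2 → ℝ := fun i j y => Z y ![orientedBasis i, orientedBasis j]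
  have h1 : (1 : WithTop ℕ∞) ≤ ∞ := WithTop.coe_le_coe.mpr le_top
  have ha : ∀ i, ContDiffOn ℝ 1 (a i) U := fun i =>
    (contDiffOn_apply hα _).of_le h1
  have hζ : ∀ i j, ContDiffOn ℝ 1 (ζ i j) U := fun i j =>
    (contDiffOn_apply hZ _).of_le h1
  have hu1 := hu.of_le h1
  -- The `X i j k` are the coefficients of the 3-form `u α ∧ Z`. The integrand is its exterior
  -- derivative, because the remaining term `u α ∧ dZ` vanishes.
  let X : Fin 4 → Fin 4 → Fin 4 → C2 → ℝ := fun i j k y =>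
    u y * (a i y * ζ j k y - a j y * ζ i k y + a k y * ζ i j y)
  have hX : ∀ i j k, ContDiffOn ℝ 1 (X i j k) U := fun i j k =>
    hu1.mul ((((ha i).mul (hζ j k)).sub ((ha j).mul (hζ i k))).add ((ha k).mul (hζ i j)))
  have hX0 : ∀ i j k, ∀ z ∈ U, z ∉ K → X i j k z = 0 := fun i j k z hz hzK => by
    simp only [X, hu0 z hz hzK, zero_mul]
  have hint := fun i j k v => setIntegral_fderiv_eq_zero hU hK hKU (hX i j k) (hX0 i j k) v
  have hpt : ∀ z ∈ U, wedge (β z) (Z z).toAlternatingMap orientedBasis =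
      fderiv ℝ (X 1 2 3) z (orientedBasis 0) - fderiv ℝ (X 0 2 3) z (orientedBasis 1) +
      fderiv ℝ (X 0 1 3) z (orientedBasis 2) - fderiv ℝ (X 0 1 2) z (orientedBasis 3) := by
    intro z hz
    have hd : ∀ {f : C2 → ℝ}, ContDiffOn ℝ 1 f U → DifferentiableAt ℝ f z := fun hf =>
      (hf.contDiffAt (hU.mem_nhds hz)).differentiableAt (by simp)
    have hXd := fun i j k v => fderiv_mul_sub_add (hd hu1) (hd (ha i)) (hd (hζ j k))
      (hd (ha j)) (hd (hζ i k)) (hd (ha k)) (hd (hζ i j)) v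
    have hcl : ∀ i j k, fderiv ℝ (ζ j k) z (orientedBasis i) -
        fderiv ℝ (ζ i k) z (orientedBasis j) + fderiv ℝ (ζ i j) z (orientedBasis k) = 0 := by
      intro i j k
      have hZd : DifferentiableAt ℝ Z z :=
        ((hZ.contDiffAt (hU.mem_nhds hz))).differentiableAt (by simp)
      have := extDeriv_apply_two hZd ![orientedBasis i, orientedBasis j, orientedBasis k]
      rw [hdZ z hz] at this
      exact this.symm
    have hζz : ∀ i j, (Z z).toAlternatingMap ![orientedBasis i, orientedBasis j] = ζ i j z :=
      fun _ _ => rfl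
    have hβz : ∀ i j, β z ![orientedBasis i, orientedBasis j] =
      fderiv ℝ u z (orientedBasis i) * a j z - fderiv ℝ u z (orientedBasis j) * a i z +
      u z * (fderiv ℝ (a j) z (orientedBasis i) - fderiv ℝ (a i) z (orientedBasis j)) :=
      fun i j => hβ z hz _ _
    rw [wedge_apply]
    simp only [hζz, hβz, X, hXd]
    linear_combination u z * a 0 z * hcl 1 2 3 - u z * a 1 z * hcl 0 2 3 +
      u z * a 2 z * hcl 0 1 3 - u z * a 3 z * hcl 0 1 2
  rw [setIntegral_congr_fun hU.measurableSet hpt, integral_sub, integral_add, integral_sub,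
    (hint 1 2 3 _).2, (hint 0 2 3 _).2, (hint 0 1 3 _).2, (hint 0 1 2 _).2]
  · simp
  · exact (hint 1 2 3 _).1
  · exact (hint 0 2 3 _).1
  · exact (hint 1 2 3 _).1.sub (hint 0 2 3 _).1
  · exact (hint 0 1 3 _).1
  · exact ((hint 1 2 3 _).1.sub (hint 0 2 3 _).1).add (hint 0 1 3 _).1
  · exact (hint 0 1 2 _).1

end Stokes
end ComplexSurface
end

noncomputable section
namespace ComplexSurface

/-! ### Stokes' theorem on a compact complex surface -/

section Differential

variable {M : Type*} [TopologicalSpace M] [ChartedSpace C2 M]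
variable {e e' : OpenPartialHomeomorph M C2} {z : C2}

/-- Smooth functions on a complex surface. -/
def IsSmoothFun (u : M → ℝ) : Prop :=
  ∀ e ∈ atlas C2 M, ContDiffOn ℝ ∞ (fun z => u (e.symm z)) e.target

/-- The differential of a function. -/
def differential (u : M → ℝ) (x : M) : C2 →L[ℝ] ℝ := mfderiv 𝓘(ℝ, C2) 𝓘(ℝ, ℝ) u x

/-- Forms of degree one as covectors. -/
def covector (A : C2 [⋀^Fin 1]→L[ℝ] ℝ) : C2 →L[ℝ] ℝ :=
  (ContinuousAlternatingMap.ofSubsingletonLIE (𝕜 := ℝ) (E := C2) (F := ℝ) (0 : Fin 1)).symm A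

/-- The form `du ∧ η`. -/
def differentialWedge (u : M → ℝ) (η : RawForm M 1) : RawForm M 2 := fun x =>
  twoForm ((differential u x).smulRight (covector (η x)))

variable [IsManifold 𝓘(ℂ, C2) ω M]

omit [IsManifold 𝓘(ℂ, C2) ω M] in
theorem IsSmoothFun.differentiableAt {u : M → ℝ} (hu : IsSmoothFun u) (he : e ∈ atlas C2 M)
    (hz : z ∈ e.target) : DifferentiableAt ℝ (fun z => u (e.symm z)) z :=
  ((hu e he).contDiffAt (e.open_target.mem_nhds hz)).differentiableAt (by simp)

/-- Since `mfderiv` is zero by default where a function is not differentiable, differentiability of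
`u` on `M` has to be recovered from its expression in the chart before the chain rule applies. -/
theorem differential_chartDeriv {u : M → ℝ} (hu : IsSmoothFun u) (he : e ∈ atlas C2 M)
    (hz : z ∈ e.target) (v : C2) :
    differential u (e.symm z) (chartDeriv e z v) = fderiv ℝ (fun z => u (e.symm z)) z v := by
  have : IsManifold 𝓘(ℝ, C2) ∞ M := isManifold_real
  have : IsManifold 𝓘(ℝ, C2) 1 M := IsManifold.of_le (n := ∞) (WithTop.coe_le_coe.mpr le_top)
  have hx : e.symm z ∈ e.source := e.map_target hz
  have hu' : MDifferentiableAt 𝓘(ℝ, C2) 𝓘(ℝ, ℝ) u (e.symm z) := by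
    have h1 : MDifferentiableAt 𝓘(ℝ, C2) 𝓘(ℝ, ℝ) (fun z => u (e.symm z)) (e (e.symm z)) := by
      rw [e.right_inv hz]
      exact (hu.differentiableAt he hz).mdifferentiableAt
    have h2 : MDifferentiableAt 𝓘(ℝ, C2) 𝓘(ℝ, C2) e (e.symm z) := mdifferentiableAt_atlas he hx
    refine (h1.comp (e.symm z) h2).congr_of_eventuallyEq ?_
    filter_upwards [e.open_source.mem_nhds hx] with y hy
    simp [e.left_inv hy]
  have h3 := (hu'.hasMFDerivAt.comp z (hasMFDerivAt_symm he hz).restrictScalars_real).hasFDerivAt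
  have h4 : fderiv ℝ (fun z => u (e.symm z)) z =
      (differential u (e.symm z)).comp ((chartDeriv e z).restrictScalars ℝ) := HasFDerivAt.fderiv h3
  rw [h4]
  rfl

theorem differentialWedge_inChart {u : M → ℝ} (hu : IsSmoothFun u) (η : RawForm M 1)
    (he : e ∈ atlas C2 M) (hz : z ∈ e.target) (v w : C2) :
    (differentialWedge u η).inChart e z ![v, w] =
      fderiv ℝ (fun z => u (e.symm z)) z v * η.inChart e z (fun _ => w) -
        fderiv ℝ (fun z => u (e.symm z)) z w * η.inChart e z (fun _ => v) := by
  rw [RawForm.inChart_apply _ he hz, RawForm.inChart_apply _ he hz, RawForm.inChart_apply _ he hz,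
    ← differential_chartDeriv hu he hz, ← differential_chartDeriv hu he hz]
  exact twoForm_apply _ _

theorem RawForm.continuousOn_coeff_wedge (he : e ∈ atlas C2 M) {α β : RawForm M 2}
    (hα : ∀ v w, ContinuousOn (fun z => α.inChart e z ![v, w]) e.target)
    (hβ : ∀ v w, ContinuousOn (fun z => β.inChart e z ![v, w]) e.target) :
    ContinuousOn ((α.wedge β).coeff e) e.target := by
  have h : ∀ i j k l, ContinuousOn (fun z =>
      (α.inChart e z).toAlternatingMap ![orientedBasis i, orientedBasis j] *
        (β.inChart e z).toAlternatingMap ![orientedBasis k, orientedBasis l]) e.target :=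
    fun i j k l => (hα _ _).mul (hβ _ _)
  refine ContinuousOn.congr (((((((h 0 1 2 3).sub (h 0 2 1 3)).add (h 0 3 1 2)).add
    (h 1 2 0 3)).sub (h 1 3 0 2)).add (h 2 3 0 1))) fun z hz => ?_
  rw [RawForm.coeff_wedge he hz, wedge_apply]
  rfl

omit [IsManifold 𝓘(ℂ, C2) ω M] in
theorem RawForm.IsSmooth.continuousOn_apply {k : ℕ} {α : RawForm M k} (hα : α.IsSmooth)
    (he : e ∈ atlas C2 M) (v : Fin k → C2) : ContinuousOn (fun z => α.inChart e z v) e.target :=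
  (contDiffOn_apply (hα e he) v).continuousOn

theorem continuousOn_differentialWedge {u : M → ℝ} (hu : IsSmoothFun u) {η : RawForm M 1}
    (hη : η.IsSmooth) (he : e ∈ atlas C2 M) (v w : C2) :
    ContinuousOn (fun z => (differentialWedge u η).inChart e z ![v, w]) e.target := by
  have h1 : ∀ v, ContinuousOn (fun z => fderiv ℝ (fun z => u (e.symm z)) z v) e.target := fun v =>
    ((hu e he).continuousOn_fderiv_of_isOpen e.open_target
      (WithTop.coe_le_coe.mpr le_top)).clm_apply continuousOn_const
  exact (((h1 v).mul (hη.continuousOn_apply he _)).sub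
    ((h1 w).mul (hη.continuousOn_apply he _))).congr fun z hz =>
      differentialWedge_inChart hu η he hz v w

open MeasureTheory

omit [ChartedSpace C2 M] [IsManifold 𝓘(ℂ, C2) ω M] in
-- The function is continuous on the compact image of `K` and zero on the rest of the target.
theorem integrableOn_target {f : C2 → ℝ} (hf : ContinuousOn f e.target) {K : Set M}
    (hK : IsCompact K) (hKe : K ⊆ e.source) (h0 : ∀ z ∈ e.target, e.symm z ∉ K → f z = 0) :
    IntegrableOn f e.target := by
  have hK' : IsCompact (e '' K) := hK.image_of_continuousOn (e.continuousOn.mono hKe)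
  have hsub : e '' K ⊆ e.target := by
    rintro _ ⟨x, hx, rfl⟩
    exact e.map_source (hKe hx)
  have h1 : IntegrableOn f (e '' K) := (hf.mono hsub).integrableOn_compact hK'
  refine h1.of_forall_sdiff_eq_zero e.open_target.measurableSet fun z hz => h0 z hz.1 fun hzK => ?_
  exact hz.2 ⟨_, hzK, e.right_inv hz.1⟩

omit [IsManifold 𝓘(ℂ, C2) ω M] in
theorem eq_zero_of_notMem_tsupport {u : M → ℝ} {x : M} (hx : x ∉ tsupport u) :
    u x = 0 ∧ differential u x = 0 := by
  have h : u =ᶠ[𝓝 x] fun _ => 0 := by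
    filter_upwards [(isClosed_tsupport u).isOpen_compl.mem_nhds hx] with y hy
    exact image_eq_zero_of_notMem_tsupport hy
  refine ⟨h.eq_of_nhds, ?_⟩
  rw [differential, h.mfderiv_eq, mfderiv_const]
  rfl

omit [IsManifold 𝓘(ℂ, C2) ω M] in
theorem differentialWedge_eq_zero {u : M → ℝ} (η : RawForm M 1) {x : M} (hx : x ∉ tsupport u) :
    differentialWedge u η x = 0 := by
  rw [differentialWedge, (eq_zero_of_notMem_tsupport hx).2]
  exact (congrArg twoForm (by ext; simp)).trans (map_zero twoForm)

/-- Stokes' theorem in a chart. -/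
theorem chartIntegral_exact [CompactSpace M] (he : e ∈ atlas C2 M) {u : M → ℝ} (hu : IsSmoothFun u)
    (hue : tsupport u ⊆ e.source) {η : RawForm M 1} (hη : η.IsSmooth) {ζ : RawForm M 2}
    (hηζ : η.HasExtDeriv ζ) {Z : RawForm M 2} (hZ : Z.IsSmooth) (hdZ : Z.HasExtDeriv 0) :
    TopForm.chartIntegral
      (RawForm.wedge (fun x => differentialWedge u η x + u x • ζ x) Z) e = 0 := by
  have hK : IsCompact (e '' tsupport u) :=
    (isClosed_tsupport u).isCompact.image_of_continuousOn (e.continuousOn.mono hue)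
  have hKe : e '' tsupport u ⊆ e.target := by
    rintro _ ⟨x, hx, rfl⟩
    exact e.map_source (hue hx)
  set β : RawForm M 2 := fun x => differentialWedge u η x + u x • ζ x
  have h1 : TopForm.chartIntegral (RawForm.wedge β Z) e =
      ∫ z in e.target, wedge (β.inChart e z).toAlternatingMap
        (Z.inChart e z).toAlternatingMap orientedBasis :=
    setIntegral_congr_fun e.open_target.measurableSet fun z hz => RawForm.coeff_wedge he hz β Z
  rw [h1]
  refine setIntegral_wedge_exact e.open_target hK hKe (hu e he) ?_ (hη e he) (hZ e he)
    (hdZ e he) ?_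
  · intro z hz hzK
    exact (eq_zero_of_notMem_tsupport fun h => hzK ⟨_, h, e.right_inv hz⟩).1
  · intro z hz v w
    have h2 : β.inChart e z ![v, w] =
        (differentialWedge u η).inChart e z ![v, w] + u (e.symm z) * ζ.inChart e z ![v, w] := rfl
    have h3 : DifferentiableAt ℝ (η.inChart e) z :=
      ((hη e he).contDiffAt (e.open_target.mem_nhds hz)).differentiableAt (by simp)
    refine h2.trans ?_
    rw [differentialWedge_inChart hu η he hz, ← hηζ e he z hz, extDeriv_apply_one h3]
    rfl

end Differential
end ComplexSurface
end

/-! ### Globalization of Stokes' theorem by a partition of unity -/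

noncomputable section
namespace ComplexSurface

section Global

open MeasureTheory

variable {M : Type*} [TopologicalSpace M] [ChartedSpace C2 M] [IsManifold 𝓘(ℂ, C2) ω M]
  [T2Space M] [CompactSpace M]

theorem isSmoothFun_chartPartition (p : M) : IsSmoothFun (chartPartition M p) := by
  intro e he
  have : IsManifold 𝓘(ℝ, C2) ∞ M := isManifold_real
  have h1 : ContMDiffOn 𝓘(ℝ, C2) 𝓘(ℝ, C2) ∞ e.symm e.target :=
    contMDiffOn_symm_of_mem_maximalAtlas (IsManifold.subset_maximalAtlas he)
  have h2 : ContMDiff 𝓘(ℝ, C2) 𝓘(ℝ, ℝ) ∞ (chartPartition M p) := (chartPartition M p).contMDiff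
  exact (h2.comp_contMDiffOn h1).contDiffOn

theorem tsupport_chartPartition (p : M) :
    tsupport (chartPartition M p) ⊆ (chartAt C2 p).source := by
  have : IsManifold 𝓘(ℝ, C2) ∞ M := isManifold_real
  exact (SmoothPartitionOfUnity.exists_isSubordinate_chartAt_source 𝓘(ℝ, C2) M).choose_spec p

/-- A locally finite family on a compact space has only finitely many nonzero members, so the
`finsum` in `integral` becomes a finite sum. -/
theorem exists_finset_chartPartition (M : Type*) [TopologicalSpace M] [ChartedSpace C2 M]
    [IsManifold 𝓘(ℂ, C2) ω M] [T2Space M] [CompactSpace M] :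
    ∃ s : Finset M, (∀ p, p ∉ s → ∀ x, chartPartition M p x = 0) ∧
      ∀ x, ∑ p ∈ s, chartPartition M p x = 1 := by
  have hfin : {p : M | (Function.support (chartPartition M p)).Nonempty}.Finite :=
    (chartPartition M).locallyFinite.finite_nonempty_of_compact
  have h0 : ∀ p, p ∉ hfin.toFinset → ∀ x, chartPartition M p x = 0 := by
    intro p hp x
    by_contra hx
    exact hp (hfin.mem_toFinset.mpr ⟨x, hx⟩)
  refine ⟨hfin.toFinset, h0, fun x => ?_⟩
  rw [← (chartPartition M).sum_eq_one (Set.mem_univ x)]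
  refine (finsum_eq_sum_of_support_subset _ fun p hp => ?_).symm
  by_contra h
  exact hp (h0 p h x)

omit [IsManifold 𝓘(ℂ, C2) ω M] [T2Space M] [CompactSpace M] in
theorem TopForm.chartIntegral_eq_zero {μ : TopForm M} (h : ∀ x, μ x = 0)
    (e : OpenPartialHomeomorph M C2) : μ.chartIntegral e = 0 := by
  have h1 : μ.coeff e = fun _ => 0 := by
    funext z
    rw [TopForm.coeff, h]
    rfl
  rw [TopForm.chartIntegral, h1, integral_zero]

theorem integral_eq_sum {s : Finset M} (hs : ∀ p, p ∉ s → ∀ x, chartPartition M p x = 0)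
    (μ : TopForm M) :
    integral μ = ∑ p ∈ s,
      TopForm.chartIntegral (fun x => chartPartition M p x • μ x) (chartAt C2 p) := by
  have h1 : ∀ p : M, (∫ z in (chartAt C2 p).target, chartPartition M p ((chartAt C2 p).symm z) *
      μ ((chartAt C2 p).symm z)
        (fun i => mfderiv 𝓘(ℝ, C2) 𝓘(ℝ, C2) (chartAt C2 p).symm z (orientedBasis i))) =
      TopForm.chartIntegral (fun x => chartPartition M p x • μ x) (chartAt C2 p) := by
    intro p
    refine setIntegral_congr_fun (chartAt C2 p).open_target.measurableSet fun z hz => ?_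
    have h2 : (fun i => (mfderiv 𝓘(ℝ, C2) 𝓘(ℝ, C2) (chartAt C2 p).symm z : C2 →L[ℝ] C2)
        (orientedBasis i)) = fun i => chartDeriv (chartAt C2 p) z (orientedBasis i) := by
      rw [mfderiv_symm (chart_mem_atlas C2 p) hz]
      rfl
    exact congrArg (fun b : Fin 4 → C2 => chartPartition M p ((chartAt C2 p).symm z) *
      μ ((chartAt C2 p).symm z) b) h2
  rw [integral, finsum_congr h1]
  refine finsum_eq_sum_of_support_subset _ fun p hp => ?_
  by_contra h
  refine hp ?_
  exact TopForm.chartIntegral_eq_zero (fun x => by rw [hs p h, zero_smul]) _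

omit [IsManifold 𝓘(ℂ, C2) ω M] [T2Space M] in
theorem integrableOn_coeff {e : OpenPartialHomeomorph M C2} {μ : TopForm M}
    (hμ : ContinuousOn (μ.coeff e) e.target) {K : Set M} (hK : IsClosed K) (hKe : K ⊆ e.source)
    (h0 : ∀ x, x ∉ K → μ x = 0) : IntegrableOn (μ.coeff e) e.target :=
  integrableOn_target hμ hK.isCompact hKe fun z _ hz => by
    rw [TopForm.coeff, h0 _ hz]
    rfl

omit [IsManifold 𝓘(ℂ, C2) ω M] [T2Space M] [CompactSpace M] in
theorem TopForm.chartIntegral_sum {ι : Type*} (s : Finset ι) {e : OpenPartialHomeomorph M C2}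
    (μ : ι → TopForm M) (h : ∀ i ∈ s, IntegrableOn ((μ i).coeff e) e.target) :
    TopForm.chartIntegral (fun x => ∑ i ∈ s, μ i x) e = ∑ i ∈ s, (μ i).chartIntegral e := by
  simp only [TopForm.chartIntegral]
  rw [← integral_finsetSum s h]
  congr 1
  funext z
  exact map_sum (⟨⟨fun A => A fun i => chartDeriv e z (orientedBasis i), rfl⟩, fun _ _ => rfl⟩ :
    (T (e.symm z) [⋀^Fin 4]→ₗ[ℝ] ℝ) →+ ℝ) (fun i => μ i (e.symm z)) s

omit [IsManifold 𝓘(ℂ, C2) ω M] [T2Space M] [CompactSpace M] in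
theorem TopForm.chartIntegral_add {e : OpenPartialHomeomorph M C2} {μ ν : TopForm M}
    (hμ : IntegrableOn (μ.coeff e) e.target) (hν : IntegrableOn (ν.coeff e) e.target) :
    TopForm.chartIntegral (fun x => μ x + ν x) e = μ.chartIntegral e + ν.chartIntegral e :=
  integral_add hμ hν

omit [IsManifold 𝓘(ℂ, C2) ω M] [T2Space M] [CompactSpace M] in
theorem continuousOn_smul_coeff {u : M → ℝ} (hu : IsSmoothFun u) {e : OpenPartialHomeomorph M C2}
    (he : e ∈ atlas C2 M) {μ : TopForm M} (hμ : ContinuousOn (μ.coeff e) e.target) :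
    ContinuousOn (TopForm.coeff (fun x => u x • μ x) e) e.target :=
  (hu e he).continuousOn.mul hμ

theorem sum_differential_chartPartition {s : Finset M}
    (hs : ∀ x, ∑ p ∈ s, chartPartition M p x = 1) (x : M) :
    ∑ p ∈ s, differential (chartPartition M p) x = 0 := by
  have he := chart_mem_atlas C2 x
  have hz := mem_chart_target C2 x
  have hx := (chartAt C2 x).left_inv (mem_chart_source C2 x)
  ext w
  obtain ⟨v, rfl⟩ := chartDeriv_surjective he hz w
  have h1 : ∀ p, differential (chartPartition M p) x
      (chartDeriv (chartAt C2 x) (chartAt C2 x x) v) =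
      fderiv ℝ (fun z => chartPartition M p ((chartAt C2 x).symm z)) (chartAt C2 x x) v := fun p => by
    have := differential_chartDeriv (isSmoothFun_chartPartition p) he hz v
    rwa [hx] at this
  rw [_root_.sum_apply]
  simp only [h1]
  rw [← _root_.sum_apply, ← fderiv_fun_sum fun p _ =>
    (isSmoothFun_chartPartition p).differentiableAt he hz]
  simp [hs]

/-- Stokes' theorem: the integral of `dη ∧ Z` vanishes if `Z` is closed. -/
theorem integral_wedge_exact {η : RawForm M 1} (hη : η.IsSmooth) {ζ : RawForm M 2}
    (hηζ : η.HasExtDeriv ζ) (hζ : ζ.IsSmooth) {Z : RawForm M 2} (hZ : Z.IsSmooth)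
    (hdZ : Z.HasExtDeriv 0) : integral (ζ.wedge Z) = 0 := by
  obtain ⟨s, hs0, hs1⟩ := exists_finset_chartPartition M
  set ρ : M → M → ℝ := fun p => chartPartition M p with hρ
  have hρs : ∀ p, IsSmoothFun (ρ p) := isSmoothFun_chartPartition
  have hρt : ∀ p, tsupport (ρ p) ⊆ (chartAt C2 p).source := tsupport_chartPartition
  -- These are the error terms `dρ_p ∧ η ∧ Z` left when Stokes' theorem in a chart is applied to
  -- `ρ_p η`.
  let ν : M → TopForm M := fun p => (differentialWedge (ρ p) η).wedge Z
  have hνc : ∀ p, ∀ e ∈ atlas C2 M, ContinuousOn ((ν p).coeff e) e.target := fun p e he =>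
    RawForm.continuousOn_coeff_wedge he (continuousOn_differentialWedge (hρs p) hη he)
      fun v w => hZ.continuousOn_apply he _
  have hμc : ∀ e ∈ atlas C2 M, ContinuousOn ((ζ.wedge Z).coeff e) e.target := fun e he =>
    RawForm.continuousOn_coeff_wedge he (fun v w => hζ.continuousOn_apply he _)
      fun v w => hZ.continuousOn_apply he _
  have hwedge : ∀ (α β γ : C2 [⋀^Fin 2]→L[ℝ] ℝ) (c : ℝ),
      wedge (α + c • β).toAlternatingMap γ.toAlternatingMap =
        wedge α.toAlternatingMap γ.toAlternatingMap +
          c • wedge β.toAlternatingMap γ.toAlternatingMap := by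
    intro α β γ c
    ext v
    simp only [AlternatingMap.add_apply, AlternatingMap.smul_apply, wedge_apply]
    simp
    ring
  have hν0 : ∀ p x, x ∉ tsupport (ρ p) → ν p x = 0 := by
    intro p x hx
    have h1 := hwedge 0 0 (Z x) 1
    simp only [smul_zero, add_zero, one_smul, left_eq_add] at h1
    have h2 : differentialWedge (ρ p) η x = 0 := differentialWedge_eq_zero η hx
    refine Eq.trans ?_ h1
    exact congrArg (fun A : C2 [⋀^Fin 2]→L[ℝ] ℝ =>
      wedge A.toAlternatingMap (Z x).toAlternatingMap) h2
  have hρ0 : ∀ p x, x ∉ tsupport (ρ p) → ρ p x = 0 := fun p x hx =>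
    image_eq_zero_of_notMem_tsupport hx
  have hstokes : ∀ p, TopForm.chartIntegral (fun x => ρ p x • ζ.wedge Z x) (chartAt C2 p) =
      -(ν p).chartIntegral (chartAt C2 p) := by
    intro p
    have he := chart_mem_atlas C2 p
    have h1 := chartIntegral_exact he (hρs p) (hρt p) hη hηζ hZ hdZ
    have h2 : RawForm.wedge (fun x => differentialWedge (ρ p) η x + ρ p x • ζ x) Z =
        fun x => ν p x + ρ p x • ζ.wedge Z x := funext fun x => hwedge _ _ _ _
    rw [h2, TopForm.chartIntegral_add
      (integrableOn_coeff (hνc p _ he) (isClosed_tsupport (ρ p)) (hρt p) (hν0 p))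
      (integrableOn_coeff (continuousOn_smul_coeff (hρs p) he (hμc _ he))
        (isClosed_tsupport (ρ p)) (hρt p) fun x hx => by rw [hρ0 p x hx, zero_smul])] at h1
    linarith
  -- The error terms cancel only after summation over `p`, but each is integrated in its own chart.
  -- A second use of the partition moves the pieces `ρ_q ν_p` to the chart at `q`, where they can be
  -- added.
  have hsplit : ∀ p, (ν p).chartIntegral (chartAt C2 p) =
      ∑ q ∈ s, TopForm.chartIntegral (fun x => ρ q x • ν p x) (chartAt C2 q) := by
    intro p
    have he := chart_mem_atlas C2 p
    have h1 : ν p = fun x => ∑ q ∈ s, ρ q x • ν p x := by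
      funext x
      rw [← Finset.sum_smul, hs1 x, one_smul]
    conv_lhs => rw [h1]
    rw [TopForm.chartIntegral_sum s (fun q x => ρ q x • ν p x) fun q _ =>
      integrableOn_coeff (continuousOn_smul_coeff (hρs q) he (hνc p _ he))
        (isClosed_tsupport (ρ p)) (hρt p) fun x hx => by rw [hν0 p x hx, smul_zero]]
    refine Finset.sum_congr rfl fun q _ => TopForm.chartIntegral_eq _ he (chart_mem_atlas C2 q)
      (fun x hx => ?_) fun x hx => ?_
    · rw [hν0 p x fun h => hx (hρt p h), smul_zero]
    · rw [hρ0 q x fun h => hx (hρt q h), zero_smul]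
  -- The map `L ↦ L ∧ η ∧ Z` is additive in the covector `L`, and the differentials `dρ_p` add up to
  -- `d1 = 0`.
  have hsum : ∀ x, ∑ p ∈ s, ν p x = 0 := by
    intro x
    let Φ : (C2 →L[ℝ] ℝ) →+ C2 [⋀^Fin 4]→ₗ[ℝ] ℝ := AddMonoidHom.mk'
      (fun L => wedge (twoForm (L.smulRight (covector (η x)))).toAlternatingMap
        (Z x).toAlternatingMap) fun L L' => by
      have h1 : (L + L').smulRight (covector (η x)) =
          L.smulRight (covector (η x)) + L'.smulRight (covector (η x)) := by
        ext
        simp [add_mul]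
      have h2 := hwedge (twoForm (L.smulRight (covector (η x))))
        (twoForm (L'.smulRight (covector (η x)))) (Z x) 1
      rw [one_smul, one_smul] at h2
      rw [h1, map_add]
      exact h2
    have h1 := map_sum Φ (fun p => differential (ρ p) x) s
    rw [sum_differential_chartPartition hs1, map_zero] at h1
    exact h1.symm
  rw [integral_eq_sum hs0, Finset.sum_congr rfl fun p _ => hstokes p, Finset.sum_neg_distrib,
    Finset.sum_congr rfl fun p _ => hsplit p, Finset.sum_comm]
  rw [neg_eq_zero]
  refine Finset.sum_eq_zero fun q _ => ?_
  have he := chart_mem_atlas C2 q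
  rw [← TopForm.chartIntegral_sum s (fun p x => ρ q x • ν p x) fun p _ =>
      integrableOn_coeff (continuousOn_smul_coeff (hρs q) he (hνc p _ he))
        (isClosed_tsupport (ρ q)) (hρt q) fun x hx => by rw [hρ0 q x hx, zero_smul]]
  exact TopForm.chartIntegral_eq_zero (fun x => by rw [← Finset.smul_sum, hsum, smul_zero]) _

end Global
end ComplexSurface
end

noncomputable section
namespace ComplexSurface

/-! ### The first Chern class -/

theorem iddbar_add {f k : C2 → ℝ} {z : C2} (hf : ContDiffAt ℝ 2 f z) (hk : ContDiffAt ℝ 2 k z) :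
    iddbar (fun y => f y + k y) z = iddbar f z + iddbar k z := by
  have hd : ∀ {f : C2 → ℝ}, ContDiffAt ℝ 2 f z → DifferentiableAt ℝ (dc f) z := fun hf =>
    (contDiffAt_dc (n := 1) (by simpa [one_add_one_eq_two] using hf)).differentiableAt (by simp)
  have h1 : dc (fun y => f y + k y) =ᶠ[𝓝 z] fun y => dc f y + dc k y := by
    filter_upwards [hf.eventually (by simp), hk.eventually (by simp)] with y h2 h3
    ext v
    rw [ContinuousAlternatingMap.add_apply, dc_apply, dc_apply, dc_apply,
      fderiv_fun_add (h2.differentiableAt (by simp)) (h3.differentiableAt (by simp)), add_apply]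
    ring
  rw [iddbar, h1.extDeriv_eq, extDeriv_fun_add (hd hf) (hd hk), smul_add]
  rfl

theorem contDiffOn_extDeriv {k : ℕ} {U : Set C2} (hU : IsOpen U) {α : C2 → C2 [⋀^Fin k]→L[ℝ] ℝ}
    (hα : ContDiffOn ℝ ∞ α U) : ContDiffOn ℝ ∞ (extDeriv α) U :=
  (ContinuousAlternatingMap.alternatizeUncurryFinCLM ℝ C2 ℝ).contDiff.comp_contDiffOn
    (hα.fderiv_of_isOpen hU le_rfl)

section Chern

variable {M : Type*} [TopologicalSpace M] [ChartedSpace C2 M]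
variable {e : OpenPartialHomeomorph M C2} {z : C2}

theorem RawForm.IsSmooth.add {k : ℕ} {α β : RawForm M k} (hα : α.IsSmooth) (hβ : β.IsSmooth) :
    (α + β).IsSmooth := fun e he => (hα e he).add (hβ e he)

theorem RawForm.IsSmooth.const_smul {k : ℕ} {α : RawForm M k} (hα : α.IsSmooth) (c : ℝ) :
    RawForm.IsSmooth (c • α) := fun e he => (hα e he).const_smul c

theorem RawForm.IsSmooth.differentiableAt {k : ℕ} {α : RawForm M k} (hα : α.IsSmooth)
    (he : e ∈ atlas C2 M) (hz : z ∈ e.target) : DifferentiableAt ℝ (α.inChart e) z :=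
  ((hα e he).contDiffAt (e.open_target.mem_nhds hz)).differentiableAt (by simp)

theorem RawForm.HasExtDeriv.add {k : ℕ} {α β : RawForm M k} {α' β' : RawForm M (k + 1)}
    (h : α.HasExtDeriv α') (h' : β.HasExtDeriv β') (hα : α.IsSmooth) (hβ : β.IsSmooth) :
    (α + β).HasExtDeriv (α' + β') := fun e he z hz =>
  (extDeriv_fun_add (hα.differentiableAt he hz) (hβ.differentiableAt he hz)).trans
    (congrArg₂ (· + ·) (h e he z hz) (h' e he z hz))

theorem RawForm.HasExtDeriv.const_smul {k : ℕ} {α : RawForm M k} {α' : RawForm M (k + 1)}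
    (h : α.HasExtDeriv α') (c : ℝ) : RawForm.HasExtDeriv (c • α) (c • α') := fun e he z hz =>
  (extDeriv_fun_smul c (α.inChart e)).trans (congrArg (c • ·) (h e he z hz))

/-- The exterior derivative of a smooth form is smooth. -/
theorem RawForm.HasExtDeriv.isSmooth {k : ℕ} {α : RawForm M k} {α' : RawForm M (k + 1)}
    (h : α.HasExtDeriv α') (hα : α.IsSmooth) : α'.IsSmooth := fun e he =>
  (contDiffOn_extDeriv e.open_target (hα e he)).congr fun z hz => (h e he z hz).symm

/-- Exact forms are closed. -/
theorem RawForm.HasExtDeriv.closed {k : ℕ} {α : RawForm M k} {α' : RawForm M (k + 1)}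
    (h : α.HasExtDeriv α') (hα : α.IsSmooth) : α'.HasExtDeriv 0 := fun e he z hz => by
  have h1 : α'.inChart e =ᶠ[𝓝 z] extDeriv (α.inChart e) := by
    filter_upwards [e.open_target.mem_nhds hz] with y hy using (h e he y hy).symm
  rw [h1.extDeriv_eq, extDeriv_extDeriv_apply
    ((hα e he).contDiffAt (e.open_target.mem_nhds hz)) (by
      simp [minSmoothness_of_isRCLikeNormedField]; exact WithTop.coe_le_coe.mpr le_top)]
  rfl

/-- The form `d^c u` of a function `u` on a complex surface. -/
def dcForm (u : M → ℝ) : RawForm M 1 := fun x => oneForm (-(differential u x ∘L mulI))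

variable [IsManifold 𝓘(ℂ, C2) ω M]

theorem dcForm_inChart {u : M → ℝ} (hu : IsSmoothFun u) (he : e ∈ atlas C2 M) (hz : z ∈ e.target) :
    (dcForm u).inChart e z = dc (fun y => u (e.symm y)) z := by
  ext v
  rw [RawForm.inChart_apply _ he hz, dc_apply, ← differential_chartDeriv hu he hz, chartDeriv_mulI]
  rfl

theorem isSmooth_dcForm {u : M → ℝ} (hu : IsSmoothFun u) : (dcForm u).IsSmooth := fun e he =>
  ContDiffOn.congr (fun _ hz => (contDiffAt_dc
    (((hu e he).contDiffAt (e.open_target.mem_nhds hz)))).contDiffWithinAt)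
    fun _ hz => dcForm_inChart hu he hz

/-- The logarithm of the quotient of two Hermitian metrics on the canonical bundle. -/
def logQuotient (h k : CanonicalHermitianMetric M) (x : M) : ℝ :=
  Real.log (h.normSq x ((Pi.basisFun ℂ (Fin 2)).det : C2 [⋀^Fin 2]→ₗ[ℂ] ℂ)) -
    Real.log (k.normSq x ((Pi.basisFun ℂ (Fin 2)).det : C2 [⋀^Fin 2]→ₗ[ℂ] ℂ))

/-- Changing the nonzero element of the fibre multiplies both squared norms by the same factor.
Hence the reference element in `logQuotient`, which need not vary smoothly from point to point, can
be replaced by the smooth frame of the chart. -/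
theorem logQuotient_symm (h k : CanonicalHermitianMetric M) (he : e ∈ atlas C2 M)
    (hz : z ∈ e.target) : logQuotient h k (e.symm z) =
      Real.log (h.normSq (e.symm z) (frame e (e.symm z))) -
        Real.log (k.normSq (e.symm z) (frame e (e.symm z))) := by
  set x := e.symm z
  set α : K x := ((Pi.basisFun ℂ (Fin 2)).det : C2 [⋀^Fin 2]→ₗ[ℂ] ℂ)
  have hf := frame_ne_zero he hz
  have h1 : frame e x = canonicalCoeff (frame e x) • α := eq_canonicalCoeff_smul _
  have hc : 0 < ‖canonicalCoeff (frame e x)‖ ^ 2 := by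
    have := norm_pos_iff.mpr (canonicalCoeff_ne_zero hf)
    positivity
  have hα : α ≠ 0 := fun h0 => hf (by rw [h1, h0, smul_zero])
  have h2 : ∀ m : CanonicalHermitianMetric M, Real.log (m.normSq x (frame e x)) =
      Real.log (‖canonicalCoeff (frame e x)‖ ^ 2) + Real.log (m.normSq x α) := fun m => by
    conv_lhs => rw [h1]
    rw [m.normSq_smul, Real.log_mul hc.ne' (m.normSq_pos x α hα).ne']
  rw [h2, h2]
  simp only [logQuotient, x, α]
  ring

theorem isSmoothFun_logQuotient (h k : CanonicalHermitianMetric M) :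
    IsSmoothFun (logQuotient h k) := fun _ he =>
  ((h.contDiffOn_log he).sub (k.contDiffOn_log he)).congr fun _ hz => logQuotient_symm h k he hz

/-- Two Chern forms differ by an exact form. -/
theorem IsChernForm.hasExtDeriv_sub {h k : CanonicalHermitianMetric M} {θ τ : RawForm M 2}
    (hθ : IsChernForm h θ) (hτ : IsChernForm k τ) :
    RawForm.HasExtDeriv ((1 / (4 * Real.pi)) • dcForm (logQuotient h k)) (θ - τ) := by
  intro e he z hz
  have hu := isSmoothFun_logQuotient h k
  set U : C2 → ℝ := fun y => logQuotient h k (e.symm y)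
  have h2 : (2 : WithTop ℕ∞) ≤ ∞ := WithTop.coe_le_coe.mpr le_top
  have hnhds := e.open_target.mem_nhds hz
  have h1 : (fun y => Real.log (h.normSq (e.symm y) (frame e (e.symm y)))) =ᶠ[𝓝 z]
      fun y => U y + Real.log (k.normSq (e.symm y) (frame e (e.symm y))) := by
    filter_upwards [hnhds] with y hy
    simp only [U, logQuotient_symm h k he hy]
    ring
  have h3 : dc (fun y => Real.log (h.normSq (e.symm y) (frame e (e.symm y)))) =ᶠ[𝓝 z]
      dc (fun y => U y + Real.log (k.normSq (e.symm y) (frame e (e.symm y)))) := by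
    filter_upwards [h1.fderiv (𝕜 := ℝ)] with y hy
    simp only [dc, hy]
  have h4 : iddbar (fun y => Real.log (h.normSq (e.symm y) (frame e (e.symm y)))) z =
      iddbar U z + iddbar (fun y => Real.log (k.normSq (e.symm y) (frame e (e.symm y)))) z := by
    rw [← iddbar_add (((hu e he).contDiffAt hnhds).of_le h2)
      (((k.contDiffOn_log he).contDiffAt hnhds).of_le h2), iddbar, h3.extDeriv_eq]
    rfl
  have h5 : (θ - τ).inChart e z = θ.inChart e z - τ.inChart e z := rfl
  have h6 : RawForm.inChart ((1 / (4 * Real.pi)) • dcForm (logQuotient h k)) e =ᶠ[𝓝 z]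
      fun y => (1 / (4 * Real.pi)) • dc U y := by
    filter_upwards [hnhds] with y hy
    rw [← dcForm_inChart hu he hy]
    rfl
  have h7 : extDeriv (fun y => (1 / (4 * Real.pi)) • dc U y) z =
      (1 / (4 * Real.pi)) • extDeriv (dc U) z := extDeriv_fun_smul _ _
  -- The constant `1/(4π)` is the `1/(2π)` of the Chern form times the `1/2` in `i∂∂̄ = (1/2) d
  -- d^c`.
  rw [h5, hθ e he z hz, hτ e he z hz, h4, h6.extDeriv_eq, h7, smul_add,
    add_sub_cancel_right, iddbar, smul_smul]
  congr 1
  field_simp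
  norm_num

variable [T2Space M] [CompactSpace M]

open MeasureTheory

omit [T2Space M] [CompactSpace M] in
theorem continuousOn_coeff_wedge_of_isSmooth {α β : RawForm M 2} (hα : α.IsSmooth)
    (hβ : β.IsSmooth) (he : e ∈ atlas C2 M) : ContinuousOn ((α.wedge β).coeff e) e.target :=
  RawForm.continuousOn_coeff_wedge he (fun _ _ => hα.continuousOn_apply he _)
    fun _ _ => hβ.continuousOn_apply he _

theorem integrableOn_chartPartition_smul {μ : TopForm M} (p : M)
    (hμ : ContinuousOn (μ.coeff (chartAt C2 p)) (chartAt C2 p).target) :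
    IntegrableOn (TopForm.coeff (fun x => chartPartition M p x • μ x) (chartAt C2 p))
      (chartAt C2 p).target :=
  integrableOn_coeff (continuousOn_smul_coeff (isSmoothFun_chartPartition p)
    (chart_mem_atlas C2 p) hμ) (isClosed_tsupport _) (tsupport_chartPartition p)
    fun x hx => by rw [image_eq_zero_of_notMem_tsupport hx, zero_smul]

theorem integral_add_of_continuousOn {μ ν : TopForm M}
    (hμ : ∀ e ∈ atlas C2 M, ContinuousOn (μ.coeff e) e.target)
    (hν : ∀ e ∈ atlas C2 M, ContinuousOn (ν.coeff e) e.target) :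
    integral (fun x => μ x + ν x) = integral μ + integral ν := by
  obtain ⟨s, hs0, hs1⟩ := exists_finset_chartPartition M
  rw [integral_eq_sum hs0, integral_eq_sum hs0, integral_eq_sum hs0, ← Finset.sum_add_distrib]
  refine Finset.sum_congr rfl fun p _ => ?_
  simp only [smul_add]
  exact TopForm.chartIntegral_add
    (integrableOn_chartPartition_smul p (hμ _ (chart_mem_atlas C2 p)))
    (integrableOn_chartPartition_smul p (hν _ (chart_mem_atlas C2 p)))

/-- The square of a closed form only depends on its cohomology class. -/
theorem intersection_self_eq {θ τ : RawForm M 2} {η : RawForm M 1} (hτ : τ.IsSmooth)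
    (hdτ : τ.HasExtDeriv 0) (hη : η.IsSmooth) (h : η.HasExtDeriv (θ - τ)) :
    intersection θ θ = intersection τ τ := by
  have hζ : RawForm.IsSmooth (θ - τ) := h.isSmooth hη
  have hdζ : RawForm.HasExtDeriv (θ - τ) 0 := h.closed hη
  -- The 2-forms commute, so `θ² - τ² = (θ - τ) ∧ (θ + τ)`. Here `θ + τ` is written as `(θ - τ) +
  -- 2τ`, since smoothness and closedness are known for `θ - τ` and `τ`.
  have hZ : RawForm.IsSmooth ((θ - τ) + (2 : ℝ) • τ) := hζ.add (hτ.const_smul 2)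
  have hdZ : RawForm.HasExtDeriv ((θ - τ) + (2 : ℝ) • τ) 0 := by
    have := hdζ.add (hdτ.const_smul 2) hζ (hτ.const_smul 2)
    rwa [smul_zero, add_zero] at this
  have h1 := integral_wedge_exact hη h hζ hZ hdZ
  have h2 : θ.wedge θ = fun x => RawForm.wedge (θ - τ) ((θ - τ) + (2 : ℝ) • τ) x + τ.wedge τ x := by
    funext x
    have h3 : ∀ a b : C2 [⋀^Fin 2]→L[ℝ] ℝ, wedge a.toAlternatingMap a.toAlternatingMap =
        wedge (a - b).toAlternatingMap ((a - b) + (2 : ℝ) • b).toAlternatingMap +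
          wedge b.toAlternatingMap b.toAlternatingMap := by
      intro a b
      ext v
      rw [AlternatingMap.add_apply, wedge_apply, wedge_apply, wedge_apply]
      simp
      ring
    exact h3 (θ x) (τ x)
  have h3 : intersection θ θ = integral (θ.wedge θ) := rfl
  have h4 : intersection τ τ = integral (τ.wedge τ) := rfl
  rw [h3, h4, h2, integral_add_of_continuousOn
    (fun e he => continuousOn_coeff_wedge_of_isSmooth hζ hZ he)
    (fun e he => continuousOn_coeff_wedge_of_isSmooth hτ hτ he), h1, zero_add]

/-- The integral of a negative form is negative. -/
theorem integral_neg_of_coeff_neg [Nonempty M] {μ : TopForm M}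
    (hμ : ∀ e ∈ atlas C2 M, ContinuousOn (μ.coeff e) e.target)
    (hneg : ∀ e ∈ atlas C2 M, ∀ z ∈ e.target, μ.coeff e z < 0) : integral μ < 0 := by
  obtain ⟨s, hs0, hs1⟩ := exists_finset_chartPartition M
  have x₀ : M := Classical.arbitrary M
  -- All summands are at most zero. Strict negativity comes from a chart whose partition function is
  -- nonzero at some point, by continuity on a nonempty open set.
  obtain ⟨p₀, hp₀, hx₀⟩ : ∃ p ∈ s, chartPartition M p x₀ ≠ 0 := by
    by_contra! h
    have := hs1 x₀
    rw [Finset.sum_eq_zero h] at this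
    exact zero_ne_one this
  have hnn : ∀ p x, 0 ≤ chartPartition M p x := fun p x => (chartPartition M).nonneg p x
  have hle : ∀ p, ∀ z ∈ (chartAt C2 p).target,
      TopForm.coeff (fun x => chartPartition M p x • μ x) (chartAt C2 p) z ≤ 0 := fun p z hz =>
    mul_nonpos_of_nonneg_of_nonpos (hnn p _) (hneg _ (chart_mem_atlas C2 p) z hz).le
  rw [integral_eq_sum hs0]
  refine Finset.sum_neg' (fun p _ => setIntegral_nonpos
    (chartAt C2 p).open_target.measurableSet (hle p)) ⟨p₀, hp₀, ?_⟩
  set e := chartAt C2 p₀ with he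
  have hea := chart_mem_atlas C2 p₀
  set f := TopForm.coeff (fun x => chartPartition M p₀ x • μ x) e
  have hfc : ContinuousOn f e.target :=
    continuousOn_smul_coeff (isSmoothFun_chartPartition p₀) hea (hμ _ hea)
  have hxs : x₀ ∈ e.source := tsupport_chartPartition p₀ (subset_tsupport _ hx₀)
  have hz₀ : e x₀ ∈ e.target := e.map_source hxs
  have hf0 : f (e x₀) < 0 := by
    refine mul_neg_of_pos_of_neg ?_ (hneg _ hea _ hz₀)
    rw [e.left_inv hxs]
    exact (hnn _ _).lt_of_ne hx₀.symm
  have h1 : 0 < ∫ z in e.target, -f z := by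
    rw [setIntegral_pos_iff_support_of_nonneg_ae]
    · have hopen : IsOpen (e.target ∩ f ⁻¹' Set.Iio 0) :=
        hfc.isOpen_inter_preimage e.open_target isOpen_Iio
      refine (hopen.measure_pos volume ⟨e x₀, hz₀, hf0⟩).trans_le (measure_mono ?_)
      rintro z ⟨hz, hfz⟩
      exact ⟨neg_ne_zero.mpr (ne_of_lt hfz), hz⟩
    · filter_upwards [ae_restrict_mem e.open_target.measurableSet] with z hz
      exact neg_nonneg.mpr (hle p₀ z hz)
    · exact (integrableOn_chartPartition_smul p₀ (hμ _ hea)).neg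
  rw [integral_neg] at h1
  exact neg_pos.mp h1

/-! ### Negativity of the first Chern number -/

namespace HermitianPseudoMetric

variable (g : HermitianPseudoMetric M)

omit [T2Space M] [CompactSpace M] in
-- In the oriented basis, `ω` has the diagonal entries of the Hermitian matrix on the pairs `(e,
-- Ie)` and, up to sign, the components of the off-diagonal entry on the mixed pairs. The six
-- shuffles give the 2 × 2 determinant twice.
theorem coeff_kahlerForm_wedge (c : ℝ) (he : e ∈ atlas C2 M) (hz : z ∈ e.target) :
    (RawForm.wedge (c • g.kahlerForm) (c • g.kahlerForm)).coeff e z =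
      2 * c ^ 2 * hermDet (bilinInChart g.toFun e z) := by
  have h1 : ∀ v w, (RawForm.inChart (c • g.kahlerForm) e z).toAlternatingMap ![v, w] =
      c * bilinInChart g.toFun e z (mulI v) w := fun v w =>
    congrArg (c * ·) (g.kahlerForm_inChart_apply he hz ![v, w])
  have hB := g.isHermitianForm_bilinInChart he hz
  obtain ⟨b1, b2, b3, b4, b5, b6⟩ := hB.apply_basis
  rw [RawForm.coeff_wedge he hz, wedge_apply]
  simp only [h1, orientedBasis, Matrix.cons_val]
  simp only [← mulI_fst, ← mulI_snd, mulI_mulI, map_neg, neg_apply] at b1 b2 b3 b4 b5 b6 ⊢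
  simp only [hermDet, ← mulI_snd]
  rw [b1, b2, b5, b6]
  ring

/-- The square of the first Chern class of an indefinite Kähler-Einstein surface is negative. -/
theorem exists_hasFirstChernSquare_neg [ConnectedSpace M] (hK : g.IsKahler) (hI : g.IsIndefinite)
    {lam : ℝ} (hlam : lam ≠ 0) (hE : g.IsEinstein lam) :
    ∃ r : ℝ, HasFirstChernSquare M r ∧ r < 0 := by
  set c : ℝ := 1 / (2 * Real.pi) * lam with hc
  have hc0 : c ≠ 0 := mul_ne_zero (by positivity) hlam
  set τ : RawForm M 2 := c • g.kahlerForm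
  have hω : g.kahlerForm.IsSmooth := fun e he => g.contDiffOn_kahlerForm he
  have hτ : τ.IsSmooth := hω.const_smul c
  have hdτ : τ.HasExtDeriv 0 := by
    have : RawForm.HasExtDeriv (c • g.kahlerForm) (c • (0 : RawForm M 3)) :=
      RawForm.HasExtDeriv.const_smul hK c
    rwa [smul_zero] at this
  have hτc : IsChernForm g.canonicalMetric τ := fun e he z hz => by
    rw [g.iddbar_log_canonicalMetric hK hE he hz, smul_smul]
    rfl
  refine ⟨intersection τ τ, ⟨⟨τ, g.canonicalMetric, τ, 0, hτc, ?_, ?_⟩, ?_⟩, ?_⟩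
  · exact fun e he => contDiffOn_const (c := (0 : C2 [⋀^Fin 1]→L[ℝ] ℝ))
  · intro e he z hz
    rw [sub_self]
    have h0 : RawForm.inChart (0 : RawForm M 1) e = fun _ => 0 := rfl
    rw [h0, extDeriv, fderiv_fun_const]
    exact map_zero (ContinuousAlternatingMap.alternatizeUncurryFinCLM ℝ C2 ℝ)
  · rintro θ ⟨h, θ₀, η, hθ₀, hη, hdη⟩
    -- The difference `θ - τ` is the sum of `θ - θ₀`, exact by assumption, and `θ₀ - τ`, exact as a
    -- difference of two Chern forms.
    have h1 := hθ₀.hasExtDeriv_sub hτc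
    have h2 : RawForm.IsSmooth ((1 / (4 * Real.pi)) • dcForm (logQuotient h g.canonicalMetric)) :=
      (isSmooth_dcForm (isSmoothFun_logQuotient _ _)).const_smul _
    have h3 := hdη.add h1 hη h2
    rw [sub_add_sub_cancel] at h3
    exact intersection_self_eq hτ hdτ (hη.add h2) h3
  · refine integral_neg_of_coeff_neg (μ := τ.wedge τ)
      (fun e he => continuousOn_coeff_wedge_of_isSmooth hτ hτ he) fun e he z hz => ?_
    rw [g.coeff_kahlerForm_wedge c he hz]
    -- The constant enters squared, so the sign of `lam` plays no role.
    exact mul_neg_of_pos_of_neg (by positivity) (g.hermDet_bilinInChart_neg hI he hz)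

end HermitianPseudoMetric
end Chern
end ComplexSurface
end

theorem proposition4 {M : Type*} [TopologicalSpace M]
    [ChartedSpace ComplexSurface.C2 M] [IsManifold 𝓘(ℂ, ComplexSurface.C2) ω M]
    [T2Space M] [CompactSpace M] [ConnectedSpace M]
    (g : ComplexSurface.HermitianPseudoMetric M) (hK : g.IsKahler) (hI : g.IsIndefinite)
    (lam : ℝ) (hlam : lam ≠ 0) (hE : g.IsEinstein lam) :
    ComplexSurface.kodairaDimension M = ⊥ ∧
      ∃ r : ℝ, ComplexSurface.HasFirstChernSquare M r ∧ r < 0 :=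
  ⟨g.kodairaDimension_eq_bot hK hI hlam hE, g.exists_hasFirstChernSquare_neg hK hI hlam hE⟩
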